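/- For $Z=(z_1,z_2)$ and $W=(w_1,w_2)$ in $\mathbb C^2$ put $\rho(Z,W)=\overline{z_1}+w_1-\overline{z_2}\,w_2$ and $\rho(Z)=\rho(Z,Z)=z_1+\overline{z_1}-|z_2|^2$, and let $\overline Z=(\overline{z_1},\overline{z_2})$. Let $\mathfrak S_2=\{Z\in\mathbb C^2:\rho(Z)>0\}$ be the Siegel domain and $\partial\mathfrak S_2=\{W\in\mathbb C^2:\rho(W)=0\}$ its boundary, and let $dm$ be the Lebesgue measure on $\partial\mathfrak S_2$, that is, $dm(W)=dm(w)\,dv$ for $W=(\tfrac12|w|^2+iv,\,w)$ with $w\in\mathbb C$, $v\in\mathbb R$. For $k\in\mathbb Z$ and $s\in\mathbb C$ the Poisson kernel of weight $k$ is $$P_k(Z,W;s)=\rho(Z)^{s}\,\rho(Z,W)^{k-s}\,\rho(\overline Z,\overline W)^{-k-s}\qquad(Z\in\mathfrak S_2,\ W\in\partial\mathfrak S_2),$$ with principal powers (all the bases have positive real part). For $Z\ne Z'$ in $\mathfrak S_2$ let $\sigma=\sigma(Z,Z')=\dfrac{|\rho(Z,Z')|^2}{\rho(Z)\rho(Z')}>1$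 and $$K(Z,Z';k,s)=\frac{\pi^{3/2}\,\Gamma(\frac32-s)}{(|k|+1-s)\,\Gamma(2-s)}\Big(\frac14\Big)^{s-1}\rho(Z,Z')^{k}\,\rho(\overline Z,\overline{Z'})^{-k}\,\sigma^{-|k|}(\sigma-1)^{|k|-s}\,F\Big(s-|k|,\,s-1-|k|;\,2s-1;\,-\frac1{\sigma-1}\Big),$$ where $F={}_2F_1$ is the principal branch of the Gauss hypergeometric function. **Theorem.** Let $k\in\{0,1,-1\}$, let $Z\neq Z'$ be points of $\mathfrak S_2$, and let $s\in\mathbb C$ be such that neither $2s-1$ nor $2(2-s)-1$ belongs to $\{0,-1,-2,\dots\}$ and, if $k=0$, $s\neq1$ (so that the right-hand sides below are defined). Then the integral $$\phi(Z,Z';k,s)=\int_{\partial\mathfrak S_2}P_k(Z,W;s)\,P_{-k}(Z',W;2-s)\,dm(W)$$ converges absolutely, and $$\phi(Z,Z';k,s)=K(Z,Z';k,s)+K(Z,Z';k,2-s)=\phi(Z',Z;-k,2-s)=K(Z',Z;-k,s)+K(Z',Z;-k,2-s).$$ -/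

import Mathlib

open MeasureTheory Filter Topology

noncomputable section

namespace SiegelProduct

/-- The form `ρ(Z, W) = conj z₁ + w₁ - conj z₂ * w₂` on `ℂ²`. -/
def rho (Z W : ℂ × ℂ) : ℂ := star Z.1 + W.1 - star Z.2 * W.2

/-- `ρ(Z) = ρ(Z, Z) = z₁ + conj z₁ - z₂ * conj z₂`, a real number. -/
def height (Z : ℂ × ℂ) : ℝ := (rho Z Z).re

/-- `height Z`, read as a complex number, is `ρ(Z, Z)`. -/
theorem coe_height (Z : ℂ × ℂ) : (height Z : ℂ) = rho Z Z := by
  apply Complex.ext <;> simp [height, rho]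
  ring

/-- The Siegel domain `𝔖₂ = {Z ∈ ℂ² : z₁ + conj z₁ - z₂ * conj z₂ > 0}`. -/
def siegelDomain : Set (ℂ × ℂ) := {Z | 0 < height Z}

/-- The boundary `∂𝔖₂ = {W ∈ ℂ² : w₁ + conj w₁ - w₂ * conj w₂ = 0}`. -/
def siegelBoundary : Set (ℂ × ℂ) := {W | height W = 0}

/-- The global coordinates `(w, v) ↦ (|w|²/2 + i v, w)`, `w ∈ ℂ`, `v ∈ ℝ`, of `∂𝔖₂`. -/
def boundaryPoint (p : ℂ × ℝ) : ℂ × ℂ := (((‖p.1‖ ^ 2 / 2 : ℝ) : ℂ) + Complex.I * (p.2 : ℂ), p.1)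

/-- The Lebesgue measure `dm` of `∂𝔖₂`: the measure `dm(w) dv` of `ℂ × ℝ`, carried to `∂𝔖₂` by the
coordinates `boundaryPoint`, as a measure on `ℂ²`. -/
def boundaryMeasure : Measure (ℂ × ℂ) := Measure.map boundaryPoint volume

theorem continuous_boundaryPoint : Continuous boundaryPoint := by
  unfold boundaryPoint
  fun_prop

/-- The points with coordinates `(w, v)` are exactly those of `∂𝔖₂`. -/
theorem range_boundaryPoint : Set.range boundaryPoint = siegelBoundary := by
  ext W
  constructor
  · rintro ⟨⟨w, v⟩, rfl⟩
    simp [siegelBoundary, height, rho, boundaryPoint, ← Complex.normSq_eq_norm_sq,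
      Complex.normSq_apply]
  · intro h
    refine ⟨(W.2, W.1.im), ?_⟩
    simp [siegelBoundary, height, rho] at h
    apply Prod.ext
    · apply Complex.ext
      · simp [boundaryPoint, -Complex.ofReal_pow, ← Complex.normSq_eq_norm_sq,
          Complex.normSq_apply]
        linarith
      · have h0 : ((‖W.2‖ : ℂ) ^ 2).im = 0 := by exact_mod_cast Complex.ofReal_im (‖W.2‖ ^ 2)
        simp [boundaryPoint, h0]
    · simp [boundaryPoint]

/-- The Poisson kernel of weight `k`,
`P_k(Z, W; s) = ρ(Z)^s ρ(Z, W)^(k - s) ρ(conj Z, conj W)^(-k - s)`, with principal powers. For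
`Z ∈ 𝔖₂` and `W ∈ ∂𝔖₂` the three bases have positive real part. -/
def poissonKernel (k : ℤ) (Z W : ℂ × ℂ) (s : ℂ) : ℂ :=
  (height Z : ℂ) ^ s * rho Z W ^ ((k : ℂ) - s) * rho (star Z) (star W) ^ (-(k : ℂ) - s)

/-- The point-pair invariant `σ(Z, Z') = |ρ(Z, Z')|² / (ρ(Z) ρ(Z'))`. -/
def sigma (Z Z' : ℂ × ℂ) : ℝ := ‖rho Z Z'‖ ^ 2 / (height Z * height Z')

/-- `g` continues the power series of `F(a, b; c; ·)` analytically from a neighbourhood of `0` to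
the open set `U`, which is star-shaped about `0`. -/
def IsHypergeometricContinuation (a b c : ℂ) (U : Set ℂ) (g : ℂ → ℂ) : Prop :=
  IsOpen U ∧ 0 ∈ U ∧ StarConvex ℝ 0 U ∧ DifferentiableOn ℂ g U ∧
    g =ᶠ[𝓝 0] fun x => ordinaryHypergeometric a b c x

open Classical in
/-- The principal branch of the Gauss hypergeometric function `F(a, b; c; x)`: the value at `x` of
the analytic continuation of the hypergeometric series along the segment from `0` to `x`. (The
series alone converges for `|x| < 1` only. The value is `0` if there is no such continuation, which
for `c ≠ 0, -1, -2, …` can occur for real `x ≥ 1` only.) -/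
def gaussF (a b c x : ℂ) : ℂ :=
  if h : ∃ y : ℂ, ∃ (U : Set ℂ) (g : ℂ → ℂ),
      IsHypergeometricContinuation a b c U g ∧ x ∈ U ∧ g x = y
  then h.choose else 0

/-- The value of `gaussF` does not depend on the continuation. -/
theorem gaussF_eq {a b c x : ℂ} {U : Set ℂ} {g : ℂ → ℂ}
    (hg : IsHypergeometricContinuation a b c U g) (hx : x ∈ U) : gaussF a b c x = g x := by
  have h : ∃ y : ℂ, ∃ (U : Set ℂ) (g : ℂ → ℂ),
      IsHypergeometricContinuation a b c U g ∧ x ∈ U ∧ g x = y := ⟨_, U, g, hg, hx, rfl⟩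
  have hval : gaussF a b c x = h.choose := by rw [gaussF, dif_pos h]
  obtain ⟨V, f, ⟨hVo, hV0, hVs, hfd, hf⟩, hxV, hfx⟩ := h.choose_spec
  obtain ⟨hUo, hU0, hUs, hgd, hg0⟩ := hg
  rw [hval, ← hfx]
  have hconn : IsPreconnected (U ∩ V) :=
    ((hUs.inter hVs).isPathConnected ⟨hU0, hV0⟩).isConnected.isPreconnected
  exact ((hfd.mono Set.inter_subset_right).analyticOnNhd
      (hUo.inter hVo)).eqOn_of_preconnected_of_eventuallyEq
    ((hgd.mono Set.inter_subset_left).analyticOnNhd (hUo.inter hVo)) hconn ⟨hU0, hV0⟩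
    (hf.trans hg0.symm) ⟨hx, hxV⟩

/-- The point-pair kernel of weight `k`,
`K(Z, Z'; k, s) = π^(3/2) Γ(3/2 - s) / ((|k| + 1 - s) Γ(2 - s)) * (1/4)^(s - 1)
  * ρ(Z, Z')^k ρ(conj Z, conj Z')^(-k) * σ^(-|k|) (σ - 1)^(|k| - s)
  * F(s - |k|, s - 1 - |k|; 2 s - 1; -1 / (σ - 1))`, where `σ = σ(Z, Z')`. -/
def pairKernel (Z Z' : ℂ × ℂ) (k : ℤ) (s : ℂ) : ℂ :=
  ((Real.pi ^ (3 / 2 : ℝ) : ℝ) : ℂ) * Complex.Gamma (3 / 2 - s) /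
      ((((|k| : ℤ) : ℂ) + 1 - s) * Complex.Gamma (2 - s)) *
    (1 / 4 : ℂ) ^ (s - 1) *
    rho Z Z' ^ k * rho (star Z) (star Z') ^ (-k) *
    (sigma Z Z' : ℂ) ^ (-|k|) *
    ((sigma Z Z' - 1 : ℝ) : ℂ) ^ (((|k| : ℤ) : ℂ) - s) *
    gaussF (s - ((|k| : ℤ) : ℂ)) (s - 1 - ((|k| : ℤ) : ℂ)) (2 * s - 1) (-1 / ((sigma Z Z' - 1 : ℝ) : ℂ))

/-- The integrand `W ↦ P_k(Z, W; s) P_{-k}(Z', W; 2 - s)`. -/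
def kernelProduct (Z Z' : ℂ × ℂ) (k : ℤ) (s : ℂ) (W : ℂ × ℂ) : ℂ :=
  poissonKernel k Z W s * poissonKernel (-k) Z' W (2 - s)

/-- `φ(Z, Z'; k, s) = ∫_{∂𝔖₂} P_k(Z, W; s) P_{-k}(Z', W; 2 - s) dm(W)`. -/
def phi (Z Z' : ℂ × ℂ) (k : ℤ) (s : ℂ) : ℂ :=
  ∫ W in siegelBoundary, kernelProduct Z Z' k s W ∂boundaryMeasure

end SiegelProduct

end

noncomputable section

namespace SiegelProduct

/-! Both sides are expressed through Gauss series in 1/σ, where σ = σ(Z, Z'), and then compared by a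
connection formula.

The integral. Write h = ρ(Z') and R = ρ(Z, Z'). A Heisenberg translation preserves dm and brings Z'
over the origin of the boundary, so that ρ(Z', W) = w₁ + h/2. The Cayley transform then sends the
boundary into the unit sphere of ℂ², with coordinates ζ₁ = 1 - h/(w₁ + h/2) and ζ₂ = √h w₂/(w₁ +
h/2), and h²|ρ(Z', W)|⁻⁴ dm becomes the surface measure, of mass 2π². Since ρ(Z, W) is affine in W,
its quotient by ρ(Z', W) is (R/h)(1 - u) with u = e₁ζ₁ + e₂ζ₂, and |e₁|² + |e₂|² = 1 - 1/σ < 1. The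
weights s and 2 - s add up to 2, which is why exactly that density splits off
(`kernelProduct_boundaryPoint_heisenbergShift`). What remains is the sphere integral of (1 - u)^(k -
s) (1 - ū)^(-k - s). Both factors are expanded in binomial series; powers of u and ū of different
degree are orthogonal, and the diagonal terms sum to 2π² F(s - k, s + k; 2; 1 - 1/σ)
(`integral_one_sub_sphereForm_cpow`, `phi_eq`). The bound |u| ≤ √(1 - 1/σ) also gives absolute
convergence.

The kernels. Pfaff's transformation moves the argument -1/(σ - 1) to 1/σ, and K becomes a constant
times σ^(-s) F(s - k, s + k; 2s - 1; 1/σ) (`pairKernel_eq`). Up to a common factor, K at s and at 2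
- s are thus the two Frobenius solutions at X = 0 of one hypergeometric equation, while F(s - k, s +
k; 2; 1 - X) is its solution regular at X = 1. `hypergeometric_connection` expresses the latter by
the former, with coefficients read off from Wronskians. Those coefficients are the constants of K
when k is 0 or 1; k = -1 follows by exchanging Z and Z'. -/

/-! ### Power series in the unit disc and the hypergeometric equation. -/

/-- Coefficients of a power series that converges absolutely in the open unit disc. -/
def UnitDiscSummable (c : ℕ → ℂ) : Prop :=
  ∀ r : ℝ, 0 ≤ r → r < 1 → Summable fun n => ‖c n‖ * r ^ n

theorem UnitDiscSummable.mul_nat {c : ℕ → ℂ} (hc : UnitDiscSummable c) :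
    UnitDiscSummable fun n => (n : ℂ) * c n := by
  intro r hr0 hr1
  obtain ⟨q, hq, hq1⟩ := exists_between hr1
  have hq0 : 0 < q := hr0.trans_lt hq
  have hlt : r / q < 1 := (div_lt_one hq0).2 hq
  have ht : Tendsto (fun n : ℕ => (n : ℝ) * (r / q) ^ n) atTop (𝓝 0) :=
    tendsto_self_mul_const_pow_of_lt_one (by positivity) hlt
  obtain ⟨M, hM⟩ := ht.bddAbove_range
  refine Summable.of_nonneg_of_le (fun n => by positivity) (fun n => ?_)
    ((hc q hq0.le hq1).mul_left M)
  have h1 : (n : ℝ) * (r / q) ^ n ≤ M := hM ⟨n, rfl⟩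
  calc ‖(n : ℂ) * c n‖ * r ^ n = ((n : ℝ) * (r / q) ^ n) * (‖c n‖ * q ^ n) := by
        rw [norm_mul, Complex.norm_natCast, div_pow]
        field_simp
    _ ≤ M * (‖c n‖ * q ^ n) := by gcongr

theorem UnitDiscSummable.shift {c : ℕ → ℂ} (hc : UnitDiscSummable c) :
    UnitDiscSummable fun n => c (n + 1) := by
  intro r hr0 hr1
  rcases hr0.eq_or_lt with rfl | hr
  · refine summable_of_ne_finset_zero (s := {0}) fun n hn => ?_
    simp at hn
    simp [hn]
  · have := ((summable_nat_add_iff 1).2 (hc r hr0 hr1)).mul_left r⁻¹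
    refine this.congr fun n => ?_
    rw [pow_succ]
    field_simp

theorem UnitDiscSummable.derivCoeff {c : ℕ → ℂ} (hc : UnitDiscSummable c) :
    UnitDiscSummable fun n => ((n : ℂ) + 1) * c (n + 1) := by
  simpa using hc.mul_nat.shift

theorem UnitDiscSummable.summable {c : ℕ → ℂ} (hc : UnitDiscSummable c) {x : ℂ} (hx : ‖x‖ < 1) :
    Summable fun n => c n * x ^ n := by
  refine Summable.of_norm ?_
  simpa [norm_mul, norm_pow] using hc ‖x‖ (norm_nonneg _) hx

theorem UnitDiscSummable.hasDerivAt {c : ℕ → ℂ} (hc : UnitDiscSummable c) {x : ℂ} (hx : ‖x‖ < 1) :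
    HasDerivAt (fun y => ∑' n, c n * y ^ n) (∑' n : ℕ, ((n : ℂ) + 1) * c (n + 1) * x ^ n) x := by
  obtain ⟨r, hr, hr1⟩ := exists_between hx
  have hr0 : 0 < r := (norm_nonneg x).trans_lt hr
  have hu : Summable fun n : ℕ => ‖(n : ℂ) * c n‖ * r ^ n * r⁻¹ :=
    (hc.mul_nat r hr0.le hr1).mul_right _
  have key := hasDerivAt_tsum_of_isPreconnected (g := fun n y => c n * y ^ n)
    (g' := fun n y => c n * ((n : ℂ) * y ^ (n - 1))) hu (Metric.isOpen_ball (x := (0 : ℂ)) (ε := r))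
    (convex_ball _ _).isPreconnected (fun n y _ => (hasDerivAt_pow n y).const_mul _)
    (fun n y hy => ?_) (Metric.mem_ball_self hr0) ((hc.summable (x := 0) (by simp)))
    (y := x) (by simpa using hr)
  · have hs : Summable fun n : ℕ => c n * ((n : ℂ) * x ^ (n - 1)) := by
      rw [← summable_nat_add_iff 1]
      refine (hc.derivCoeff.summable hx).congr fun n => ?_
      rw [Nat.add_sub_cancel]
      push_cast
      ring
    rw [hs.tsum_eq_zero_add] at key
    simp only [Nat.cast_zero, zero_mul, mul_zero, zero_add] at key
    refine key.congr_deriv (tsum_congr fun n => ?_)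
    rw [Nat.add_sub_cancel]
    push_cast
    ring
  · have hy' : ‖y‖ < r := by simpa using hy
    rcases n with _ | n
    · simp
    · rw [norm_mul, norm_mul, norm_mul, norm_pow, Nat.add_sub_cancel, pow_succ]
      have : ‖y‖ ^ n ≤ r ^ n := by gcongr
      calc ‖c (n + 1)‖ * (‖((n + 1 : ℕ) : ℂ)‖ * ‖y‖ ^ n)
          ≤ ‖c (n + 1)‖ * (‖((n + 1 : ℕ) : ℂ)‖ * r ^ n) := by gcongr
        _ = _ := by field_simp

theorem ordinaryHypergeometricCoefficient_succ {a b c : ℂ} (hc : ∀ n : ℕ, c ≠ -n) (n : ℕ) :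
    ((n : ℂ) + 1) * (c + n) * ordinaryHypergeometricCoefficient a b c (n + 1) =
      (a + n) * (b + n) * ordinaryHypergeometricCoefficient a b c n := by
  have h1 : c + n ≠ 0 := fun h => hc n (eq_neg_of_add_eq_zero_left h)
  have h2 : (ascPochhammer ℂ n).eval c ≠ 0 := by
    rw [Ne, ascPochhammer_eval_eq_zero_iff]
    rintro ⟨k, -, hk⟩
    exact hc k (by rw [hk, neg_neg])
  have h3 : ((n.factorial : ℕ) : ℂ) ≠ 0 := by exact_mod_cast n.factorial_ne_zero
  have h4 : ((n : ℂ) + 1) ≠ 0 := by exact_mod_cast n.succ_ne_zero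
  simp only [ordinaryHypergeometricCoefficient, ascPochhammer_succ_eval, Nat.factorial_succ,
    Nat.cast_mul, Nat.cast_add, Nat.cast_one]
  field_simp

/-- Ratio test: consecutive coefficients have quotient (a + n)(b + n)/((1 + n)(c + n)), which tends
to 1. -/
theorem unitDiscSummable_ordinaryHypergeometricCoefficient (a b : ℂ) {c : ℂ}
    (hc : ∀ n : ℕ, c ≠ -n) : UnitDiscSummable (ordinaryHypergeometricCoefficient a b c) := by
  intro r hr0 hr1
  obtain ⟨q, hq, hq1⟩ := exists_between hr1
  have hlim : ∀ d : ℂ, Tendsto (fun n : ℕ => (d + n) / (n : ℂ)) atTop (𝓝 1) := by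
    intro d
    have h0 : Tendsto (fun n : ℕ => d / (n : ℂ) + 1) atTop (𝓝 (0 + 1)) :=
      (tendsto_const_div_atTop_nhds_zero_nat d).add_const 1
    rw [zero_add] at h0
    refine h0.congr' ?_
    filter_upwards [eventually_ge_atTop 1] with n hn
    have : (n : ℂ) ≠ 0 := by exact_mod_cast (by omega : n ≠ 0)
    field_simp
  have hT : Tendsto (fun n : ℕ => ‖((a + n) / n) * ((b + n) / n) /
      (((1 + n) / n) * ((c + n) / n))‖ * r) atTop (𝓝 r) := by
    have := ((((hlim a).mul (hlim b)).div ((hlim 1).mul (hlim c)) (by simp)).norm).mul_const r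
    simpa using this
  refine summable_of_ratio_norm_eventually_le hq1 ?_
  filter_upwards [hT.eventually_lt_const hq, eventually_ge_atTop 1] with n hn hn1
  have hn0 : (n : ℂ) ≠ 0 := by exact_mod_cast (by omega : n ≠ 0)
  have h1 : c + n ≠ 0 := fun h => hc n (eq_neg_of_add_eq_zero_left h)
  have h4 : (1 + (n : ℂ)) ≠ 0 := by rw [add_comm]; exact_mod_cast n.succ_ne_zero
  have e : ordinaryHypergeometricCoefficient a b c (n + 1) =
      ((a + n) / n) * ((b + n) / n) / (((1 + n) / n) * ((c + n) / n)) *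
        ordinaryHypergeometricCoefficient a b c n := by
    have := ordinaryHypergeometricCoefficient_succ (a := a) (b := b) hc n
    rw [eq_comm, add_comm (n : ℂ) 1] at this
    field_simp
    linear_combination -this
  rw [e]
  generalize ((a + n) / n) * ((b + n) / n) / (((1 + n) / n) * ((c + n) / n)) = t at hn
  generalize ordinaryHypergeometricCoefficient a b c n = d
  simp only [norm_mul, norm_norm, norm_pow, Real.norm_of_nonneg hr0, pow_succ]
  calc ‖t‖ * ‖d‖ * (r ^ n * r) = ‖t‖ * r * (‖d‖ * r ^ n) := by ring
    _ ≤ q * (‖d‖ * r ^ n) := by gcongr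

theorem ordinaryHypergeometric_apply (a b c x : ℂ) :
    ordinaryHypergeometric a b c x = ∑' n, ordinaryHypergeometricCoefficient a b c n * x ^ n := by
  rw [ordinaryHypergeometric_eq_tsum]
  rfl

/-- The derivative of the hypergeometric series. -/
def hypergeometricDeriv (a b c x : ℂ) : ℂ :=
  ∑' n : ℕ, ((n : ℂ) + 1) * ordinaryHypergeometricCoefficient a b c (n + 1) * x ^ n

/-- The second derivative of the hypergeometric series. -/
def hypergeometricDeriv₂ (a b c x : ℂ) : ℂ :=
  ∑' n : ℕ, ((n : ℂ) + 1) * (((n : ℂ) + 1 + 1) *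
    ordinaryHypergeometricCoefficient a b c (n + 1 + 1)) * x ^ n

theorem hasDerivAt_ordinaryHypergeometric (a b : ℂ) {c x : ℂ} (hc : ∀ n : ℕ, c ≠ -n)
    (hx : ‖x‖ < 1) :
    HasDerivAt (ordinaryHypergeometric a b c) (hypergeometricDeriv a b c x) x := by
  have := (unitDiscSummable_ordinaryHypergeometricCoefficient a b hc).hasDerivAt hx
  rwa [← funext (ordinaryHypergeometric_apply a b c)] at this

theorem hasDerivAt_hypergeometricDeriv (a b : ℂ) {c x : ℂ} (hc : ∀ n : ℕ, c ≠ -n)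
    (hx : ‖x‖ < 1) :
    HasDerivAt (hypergeometricDeriv a b c) (hypergeometricDeriv₂ a b c x) x := by
  have : HasDerivAt (hypergeometricDeriv a b c) _ x :=
    (unitDiscSummable_ordinaryHypergeometricCoefficient a b hc).derivCoeff.hasDerivAt hx
  simpa [hypergeometricDeriv₂] using this

/-- Comparing coefficients of xⁿ turns the equation into the two-term recursion
`ordinaryHypergeometricCoefficient_succ`; a factor x only shifts a series by one index. -/
theorem hypergeometric_ode (a b : ℂ) {c x : ℂ} (hc : ∀ n : ℕ, c ≠ -n) (hx : ‖x‖ < 1) :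
    x * (1 - x) * hypergeometricDeriv₂ a b c x +
      (c - (a + b + 1) * x) * hypergeometricDeriv a b c x -
        a * b * ordinaryHypergeometric a b c x = 0 := by
  set u := ordinaryHypergeometricCoefficient a b c with hu_def
  have hu : UnitDiscSummable u := unitDiscSummable_ordinaryHypergeometricCoefficient a b hc
  have h0 : HasSum (fun n => u n * x ^ n) (ordinaryHypergeometric a b c x) := by
    rw [ordinaryHypergeometric_apply]
    exact (hu.summable hx).hasSum
  have h1 : HasSum (fun n : ℕ => ((n : ℂ) + 1) * u (n + 1) * x ^ n)
      (hypergeometricDeriv a b c x) := (hu.derivCoeff.summable hx).hasSum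
  have h2 : HasSum (fun n : ℕ => ((n : ℂ) + 1) * (((n : ℂ) + 1 + 1) * u (n + 1 + 1)) * x ^ n)
      (hypergeometricDeriv₂ a b c x) := by
    have := (hu.derivCoeff.derivCoeff.summable hx).hasSum
    simpa [hypergeometricDeriv₂] using this
  have lift : ∀ {f g : ℕ → ℂ} {s : ℂ}, HasSum f s → g 0 = 0 → (∀ n, g (n + 1) = x * f n) →
      HasSum g (x * s) := by
    intro f g s hf hg0 hg
    rw [← hasSum_nat_add_iff' 1]
    simp only [Finset.range_one, Finset.sum_singleton, hg0, sub_zero, hg]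
    exact hf.mul_left x
  have h1x : HasSum (fun n : ℕ => (n : ℂ) * u n * x ^ n) (x * hypergeometricDeriv a b c x) :=
    lift h1 (by simp) fun n => by push_cast; ring
  have h2x : HasSum (fun n : ℕ => (n : ℂ) * (((n : ℂ) + 1) * u (n + 1)) * x ^ n)
      (x * hypergeometricDeriv₂ a b c x) :=
    lift h2 (by simp) fun n => by push_cast; ring
  have h2xx : HasSum (fun n : ℕ => (n : ℂ) * ((n : ℂ) - 1) * u n * x ^ n)
      (x * (x * hypergeometricDeriv₂ a b c x)) :=
    lift h2x (by simp) fun n => by push_cast; ring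
  have H := ((((h2x.sub h2xx).add (h1.mul_left c)).sub (h1x.mul_left (a + b + 1))).sub
    (h0.mul_left (a * b)))
  have hz := H.unique (hasSum_zero.congr_fun fun n => ?_)
  · linear_combination hz
  · have := ordinaryHypergeometricCoefficient_succ (a := a) (b := b) hc n
    rw [← hu_def] at this
    linear_combination x ^ n * this

/-- A solution of the hypergeometric equation that is analytic at `0` and vanishes there is zero,
unless `c` is a nonpositive integer. -/
theorem eventually_eq_zero_of_hypergeometric_ode {a b c : ℂ} (hc : ∀ n : ℕ, c ≠ -n) {h : ℂ → ℂ}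
    (hh : AnalyticAt ℂ h 0) (h0 : h 0 = 0)
    (hode : ∀ᶠ z in 𝓝 (0 : ℂ), z * (1 - z) * deriv (deriv h) z +
      (c - (a + b + 1) * z) * deriv h z - a * b * h z = 0) :
    ∀ᶠ z in 𝓝 (0 : ℂ), h z = 0 := by
  by_contra hcon
  -- If h is not locally zero, then h = zⁿu with u(0) ≠ 0. The lowest term of the equation forces n
  -- to be an exponent at 0, that is 0 or 1 - c; both are excluded.
  obtain ⟨n, u, hu, hu0, hhu⟩ := hh.exists_eventuallyEq_pow_smul_nonzero_iff.2 hcon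
  simp only [sub_zero, smul_eq_mul] at hhu
  rcases n with _ | m
  · have := hhu.self_of_nhds
    simp [h0, hu0.symm] at this
  have hd : ∀ᶠ z in 𝓝 (0 : ℂ), deriv h z = (m + 1) * z ^ m * u z + z ^ (m + 1) * deriv u z := by
    filter_upwards [hhu.eventually_nhds, hu.eventually_analyticAt] with z hz huz
    have h1 : HasDerivAt (fun z => z ^ (m + 1) * u z)
        (((m + 1 : ℕ) : ℂ) * z ^ m * u z + z ^ (m + 1) * deriv u z) z :=
      (hasDerivAt_pow (m + 1) z).mul huz.differentiableAt.hasDerivAt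
    rw [EventuallyEq.deriv_eq hz, h1.deriv]
    push_cast
    ring
  have hdd : ∀ᶠ z in 𝓝 (0 : ℂ), z * deriv (deriv h) z =
      z ^ m * ((m + 1) * m * u z + 2 * (m + 1) * z * deriv u z + z ^ 2 * deriv (deriv u) z) := by
    filter_upwards [hd.eventually_nhds, hu.eventually_analyticAt] with z hz huz
    have h1 : HasDerivAt (fun z => (m + 1) * z ^ m * u z + z ^ (m + 1) * deriv u z)
        (((m + 1) * ((m : ℂ) * z ^ (m - 1))) * u z + (m + 1) * z ^ m * deriv u z +
          (((m + 1 : ℕ) : ℂ) * z ^ m * deriv u z + z ^ (m + 1) * deriv (deriv u) z)) z :=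
      (((hasDerivAt_pow m z).const_mul _).mul huz.differentiableAt.hasDerivAt).add
        ((hasDerivAt_pow (m + 1) z).mul huz.deriv.differentiableAt.hasDerivAt)
    rw [EventuallyEq.deriv_eq hz, h1.deriv]
    have h2 : (m : ℂ) * (z * z ^ (m - 1)) = m * z ^ m := by
      rcases m with _ | m
      · simp
      · rw [Nat.add_sub_cancel, pow_succ']
    push_cast
    linear_combination (m + 1) * u z * h2
  -- The left side of the equation divided by z^m, where n = m + 1. It vanishes off 0, hence by
  -- continuity at 0, where its value is (m + 1)(c + m)u(0).
  set Φ : ℂ → ℂ := fun z =>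
    (1 - z) * ((m + 1) * m * u z + 2 * (m + 1) * z * deriv u z + z ^ 2 * deriv (deriv u) z) +
      (c - (a + b + 1) * z) * ((m + 1) * u z + z * deriv u z) - a * b * (z * u z) with hΦ
  have hcont : ContinuousAt Φ 0 := by
    have c0 := hu.continuousAt
    have c1 := hu.deriv.continuousAt
    have c2 := hu.deriv.deriv.continuousAt
    fun_prop
  have hzero : ∀ᶠ z in 𝓝[≠] (0 : ℂ), Φ z = 0 := by
    rw [eventually_nhdsWithin_iff]
    filter_upwards [hode, hhu, hd, hdd] with z e1 e2 e3 e4 hz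
    have hz0 : z ^ m ≠ 0 := pow_ne_zero _ hz
    refine (mul_eq_zero.1 ?_).resolve_left hz0
    rw [e2, e3] at e1
    simp only [hΦ]
    linear_combination e1 - (1 - z) * e4
  have hΦ0 : Φ 0 = 0 := tendsto_nhds_unique (hcont.tendsto.mono_left nhdsWithin_le_nhds)
    (tendsto_const_nhds.congr' (hzero.mono fun z hz => hz.symm))
  have h1 : ((m : ℂ) + 1) * (c + m) * u 0 = 0 := by
    simp only [hΦ] at hΦ0
    linear_combination hΦ0
  have h2 : c + m ≠ 0 := fun h => hc m (eq_neg_of_add_eq_zero_left h)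
  have h4 : ((m : ℂ) + 1) ≠ 0 := by exact_mod_cast m.succ_ne_zero
  exact mul_ne_zero (mul_ne_zero h4 h2) hu0 h1

/-! ### Pfaff's transformation and the principal branch. -/

/-- The half plane Re z < 1/2 consists of the points closer to 0 than to 1. -/
theorem norm_div_sub_one_lt_one {z : ℂ} (hz : z.re < 1 / 2) : ‖z / (z - 1)‖ < 1 := by
  have h1 : z - 1 ≠ 0 := by
    intro h
    rw [sub_eq_zero] at h
    rw [h] at hz
    norm_num at hz
  rw [norm_div, div_lt_one (norm_pos_iff.2 h1), ← sq_lt_sq₀ (norm_nonneg _) (norm_nonneg _),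
    ← Complex.normSq_eq_norm_sq, ← Complex.normSq_eq_norm_sq, Complex.normSq_apply,
    Complex.normSq_apply]
  simp
  nlinarith

/-- Pfaff's form `(1 - z)^(-a) F(a, c - b; c; z / (z - 1))` of the hypergeometric function. -/
def pfaff (a b c z : ℂ) : ℂ :=
  (1 - z) ^ (-a) * ordinaryHypergeometric a (c - b) c (z / (z - 1))

/-- The derivative of `pfaff`. -/
def pfaffDeriv (a b c z : ℂ) : ℂ :=
  (1 - z) ^ (-a) * (a / (1 - z) * ordinaryHypergeometric a (c - b) c (z / (z - 1)) -
    hypergeometricDeriv a (c - b) c (z / (z - 1)) / (1 - z) ^ 2)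

section

variable {c z : ℂ} (hc : ∀ n : ℕ, c ≠ -n) (hz : z.re < 1 / 2)

theorem one_sub_ne_zero_of_re_lt (hz : z.re < 1 / 2) : 1 - z ≠ 0 := by
  intro h
  rw [sub_eq_zero] at h
  rw [← h] at hz
  norm_num at hz

theorem hasDerivAt_one_sub_cpow (a : ℂ) (hz : z.re < 1 / 2) :
    HasDerivAt (fun z => (1 - z) ^ (-a)) ((1 - z) ^ (-a) * (a / (1 - z))) z := by
  have hs : 1 - z ∈ Complex.slitPlane := Or.inl (by simp; linarith)
  refine (((hasDerivAt_id' z).const_sub 1).cpow_const (c := -a) hs).congr_deriv ?_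
  rw [Complex.cpow_sub _ _ (one_sub_ne_zero_of_re_lt hz), Complex.cpow_one]
  ring

theorem hasDerivAt_div_sub_one (hz : z.re < 1 / 2) :
    HasDerivAt (fun z : ℂ => z / (z - 1)) (-1 / (1 - z) ^ 2) z := by
  have h := one_sub_ne_zero_of_re_lt hz
  have h' : z - 1 ≠ 0 := fun e => h (by linear_combination -e)
  refine ((hasDerivAt_id' z).fun_div ((hasDerivAt_id' z).sub_const 1) h').congr_deriv ?_
  rw [div_eq_div_iff (pow_ne_zero 2 h') (pow_ne_zero 2 h)]
  ring

include hc hz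

theorem hasDerivAt_pfaff (a b : ℂ) : HasDerivAt (pfaff a b c) (pfaffDeriv a b c z) z := by
  have h1 := (hasDerivAt_ordinaryHypergeometric a (c - b) hc (norm_div_sub_one_lt_one hz)).comp z
    (hasDerivAt_div_sub_one hz)
  refine ((hasDerivAt_one_sub_cpow a hz).mul h1).congr_deriv ?_
  simp only [pfaffDeriv, Function.comp]
  ring

theorem hasDerivAt_pfaffDeriv (a b : ℂ) : ∃ d, HasDerivAt (pfaffDeriv a b c) d z ∧
    z * (1 - z) * d + (c - (a + b + 1) * z) * pfaffDeriv a b c z - a * b * pfaff a b c z = 0 := by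
  have hw := norm_div_sub_one_lt_one hz
  have h := one_sub_ne_zero_of_re_lt hz
  have hsub : HasDerivAt (fun z : ℂ => 1 - z) (-1) z := by
    simpa using (hasDerivAt_id z).const_sub 1
  have h1 := (hasDerivAt_ordinaryHypergeometric a (c - b) hc hw).comp z
    (hasDerivAt_div_sub_one hz)
  have h2 := (hasDerivAt_hypergeometricDeriv a (c - b) hc hw).comp z
    (hasDerivAt_div_sub_one hz)
  have h3 := (hasDerivAt_one_sub_cpow a hz).mul
    (((((hasDerivAt_const z a).div hsub h)).mul h1).sub (h2.div (hsub.pow 2) (pow_ne_zero 2 h)))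
  refine ⟨_, h3, ?_⟩
  have hode := hypergeometric_ode a (c - b) hc hw
  have e : z / (z - 1) = - (z / (1 - z)) := by
    rw [← neg_sub 1 z, div_neg]
  simp only [pfaffDeriv, pfaff, Function.comp, Pi.div_apply, Pi.mul_apply, Pi.sub_apply,
    Pi.pow_apply]
  rw [e] at hode ⊢
  generalize ordinaryHypergeometric a (c - b) c (-(z / (1 - z))) = y at *
  generalize hypergeometricDeriv a (c - b) c (-(z / (1 - z))) = y1 at *
  generalize hypergeometricDeriv₂ a (c - b) c (-(z / (1 - z))) = y2 at *
  generalize (1 - z) ^ (-a) = p at *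
  field_simp at hode ⊢
  push_cast
  linear_combination (-p) * hode

end

theorem isOpen_re_lt_half : IsOpen {z : ℂ | z.re < 1 / 2} :=
  isOpen_lt Complex.continuous_re continuous_const

theorem eventually_re_lt_half : ∀ᶠ z in 𝓝 (0 : ℂ), z.re < 1 / 2 :=
  isOpen_re_lt_half.mem_nhds (by norm_num)

theorem analyticAt_ordinaryHypergeometric (a b : ℂ) {c : ℂ} (hc : ∀ n : ℕ, c ≠ -n) :
    AnalyticAt ℂ (ordinaryHypergeometric a b c) (0 : ℂ) := by
  refine DifferentiableOn.analyticAt (s := Metric.ball 0 1) (fun z hz => ?_)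
    (Metric.ball_mem_nhds _ one_pos)
  exact (hasDerivAt_ordinaryHypergeometric a b hc
    (by simpa using hz)).differentiableAt.differentiableWithinAt

theorem differentiableOn_pfaff (a b : ℂ) {c : ℂ} (hc : ∀ n : ℕ, c ≠ -n) :
    DifferentiableOn ℂ (pfaff a b c) {z | z.re < 1 / 2} := fun _ hz =>
  (hasDerivAt_pfaff hc hz a b).differentiableAt.differentiableWithinAt

/-- Both functions solve the same hypergeometric equation near 0 and equal 1 there, so
`eventually_eq_zero_of_hypergeometric_ode` applies to their difference. -/
theorem pfaff_eventuallyEq (a b : ℂ) {c : ℂ} (hc : ∀ n : ℕ, c ≠ -n) :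
    pfaff a b c =ᶠ[𝓝 0] fun z => ordinaryHypergeometric a b c z := by
  have hp : AnalyticAt ℂ (pfaff a b c) 0 := (differentiableOn_pfaff a b hc).analyticAt
    (isOpen_re_lt_half.mem_nhds (by norm_num))
  have hball : ∀ᶠ z in 𝓝 (0 : ℂ), ‖z‖ < 1 := by
    filter_upwards [Metric.ball_mem_nhds (0 : ℂ) one_pos] with z hz using by simpa using hz
  have hd : ∀ᶠ z in 𝓝 (0 : ℂ), deriv (pfaff a b c - ordinaryHypergeometric a b c) z =
      pfaffDeriv a b c z - hypergeometricDeriv a b c z := by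
    filter_upwards [hball, eventually_re_lt_half] with z h1 h2
    exact ((hasDerivAt_pfaff hc h2 a b).sub (hasDerivAt_ordinaryHypergeometric a b hc h1)).deriv
  have key := eventually_eq_zero_of_hypergeometric_ode (a := a) (b := b) hc
    (hp.sub (analyticAt_ordinaryHypergeometric a b hc)) (by simp [pfaff]) (by
      filter_upwards [hball, eventually_re_lt_half, hd.eventually_nhds, hd] with z h1 h2 h3 h4
      obtain ⟨d, hd1, hd2⟩ := hasDerivAt_pfaffDeriv hc h2 a b
      rw [EventuallyEq.deriv_eq h3, h4,
        (hd1.fun_sub (hasDerivAt_hypergeometricDeriv a b hc h1)).deriv]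
      have := hypergeometric_ode a b hc h1
      simp only [Pi.sub_apply]
      linear_combination hd2 - this)
  filter_upwards [key] with z hz using sub_eq_zero.1 hz

/-- Pfaff's form is analytic on the half plane Re z < 1/2, which is convex and contains 0; it is
therefore an admissible continuation, and it covers every negative argument. -/
theorem gaussF_eq_pfaff (a b : ℂ) {c z : ℂ} (hc : ∀ n : ℕ, c ≠ -n) (hz : z.re < 1 / 2) :
    gaussF a b c z = pfaff a b c z := by
  refine gaussF_eq (U := {z : ℂ | z.re < 1 / 2}) ⟨isOpen_re_lt_half, by simp, ?_,
    differentiableOn_pfaff a b hc, pfaff_eventuallyEq a b hc⟩ hz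
  have hconv : Convex ℝ {z : ℂ | z.re < 1 / 2} := convex_halfSpace_re_lt _
  exact hconv.starConvex (by simp)

/-! ### Behaviour of the hypergeometric series at 1. -/

/-- Toeplitz' theorem for averages against probability weights that escape to infinity. -/
theorem tendsto_tsum_weights {l : Filter ℝ} {w : ℝ → ℕ → ℝ} (hw : ∀ᶠ X in l, ∀ n, 0 ≤ w X n)
    (hsum : ∀ᶠ X in l, HasSum (w X) 1) (h0 : ∀ n, Tendsto (fun X => w X n) l (𝓝 0))
    {d : ℕ → ℂ} {L : ℂ} (hd : Tendsto d atTop (𝓝 L)) :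
    Tendsto (fun X => ∑' n, (w X n : ℂ) * d n) l (𝓝 L) := by
  rw [Metric.tendsto_nhds]
  intro ε hε
  have he : Tendsto (fun n => ‖d n - L‖) atTop (𝓝 0) := by
    simpa using (hd.sub_const L).norm
  obtain ⟨N, hN⟩ := eventually_atTop.1 (he.eventually_lt_const (half_pos (half_pos hε)))
  have hfin : Tendsto (fun X => ∑ n ∈ Finset.range N, w X n * ‖d n - L‖) l (𝓝 0) := by
    have := tendsto_finsetSum (Finset.range N) fun n _ => (h0 n).mul_const ‖d n - L‖
    simpa using this
  filter_upwards [hw, hsum, hfin.eventually_lt_const (half_pos hε)] with X hX hs hf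
  have hsC : HasSum (fun n => (w X n : ℂ)) 1 := by
    simpa using Complex.hasSum_ofReal.2 hs
  -- Beyond N the deviation is below ε/4 and the weights have total mass 1; the finitely many terms
  -- before N contribute less than ε/2 for X far along the filter.
  have hmaj : HasSum (fun n => w X n * (ε / 2 / 2) +
      (if n ∈ Finset.range N then w X n * ‖d n - L‖ else 0))
      (1 * (ε / 2 / 2) + ∑ n ∈ Finset.range N, w X n * ‖d n - L‖) := by
    refine (hs.mul_right _).add ?_
    have : HasSum (fun n => if n ∈ Finset.range N then w X n * ‖d n - L‖ else 0)
        (∑ n ∈ Finset.range N, if n ∈ Finset.range N then w X n * ‖d n - L‖ else 0) :=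
      hasSum_sum_of_ne_finset_zero fun n hn => if_neg hn
    rwa [Finset.sum_congr rfl fun n hn => if_pos hn] at this
  have hle : ∀ n, ‖(w X n : ℂ) * (d n - L)‖ ≤ w X n * (ε / 2 / 2) +
      (if n ∈ Finset.range N then w X n * ‖d n - L‖ else 0) := by
    intro n
    rw [norm_mul, Complex.norm_real, Real.norm_of_nonneg (hX n)]
    split_ifs with hn
    · have := mul_nonneg (hX n) (half_pos (half_pos hε)).le
      linarith
    · rw [add_zero]
      exact mul_le_mul_of_nonneg_left (hN n (by simpa using hn)).le (hX n)
  have hsummable : Summable fun n => (w X n : ℂ) * (d n - L) :=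
    Summable.of_norm_bounded hmaj.summable hle
  have hsplit : HasSum (fun n => (w X n : ℂ) * d n) (∑' n, (w X n : ℂ) * (d n - L) + 1 * L) := by
    convert hsummable.hasSum.add (hsC.mul_right L) using 2
    ring
  rw [hsplit.tsum_eq, dist_eq_norm, one_mul, add_sub_cancel_right]
  calc _ ≤ _ := tsum_of_norm_bounded hmaj hle
    _ < ε := by linarith

/-- An Abelian theorem for the derivative of a power series with a simple pole at `1`. -/
theorem tendsto_one_sub_sq_mul_tsum {d : ℕ → ℂ} {L : ℂ} (hd : Tendsto d atTop (𝓝 L)) :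
    Tendsto (fun X : ℝ => (1 - (X : ℂ)) ^ 2 * ∑' n : ℕ, ((n : ℂ) + 1) * d n * (X : ℂ) ^ n)
      (𝓝[<] 1) (𝓝 L) := by
  have h01 : ∀ᶠ X : ℝ in 𝓝[<] 1, X ∈ Set.Ioo (0 : ℝ) 1 := Ioo_mem_nhdsLT one_pos
  have key := tendsto_tsum_weights (l := 𝓝[<] (1 : ℝ))
    (w := fun X n => (1 - X) ^ 2 * (((n : ℝ) + 1) * X ^ n)) ?_ ?_ ?_ hd
  · refine key.congr fun X => ?_
    rw [← tsum_mul_left]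
    refine tsum_congr fun n => ?_
    push_cast
    ring
  · filter_upwards [h01] with X hX n
    have := hX.1
    positivity
  · filter_upwards [h01] with X hX
    have h := (hasSum_choose_mul_geometric_of_norm_lt_one 1
      (by rw [Real.norm_of_nonneg hX.1.le]; exact hX.2 : ‖X‖ < 1)).mul_left ((1 - X) ^ 2)
    have h1 : (1 - X) ≠ 0 := by linarith [hX.2]
    rw [mul_one_div_cancel (pow_ne_zero _ h1)] at h
    simpa using h
  · intro n
    have : ContinuousAt (fun X : ℝ => (1 - X) ^ 2 * (((n : ℝ) + 1) * X ^ n)) 1 := by fun_prop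
    simpa using this.tendsto.mono_left nhdsWithin_le_nhds

/-- By Gauss' product for Γ the n-th coefficient behaves like Γ(c)/(Γ(a)Γ(b)) n^(a + b - c - 1); the
condition a + b = c + 1 makes the exponent zero. -/
theorem tendsto_ordinaryHypergeometricCoefficient {a b c : ℂ} (ha : ∀ n : ℕ, a ≠ -n)
    (hb : ∀ n : ℕ, b ≠ -n) (hc : ∀ n : ℕ, c ≠ -n) (hab : a + b = c + 1) :
    Tendsto (fun n => ordinaryHypergeometricCoefficient a b c (n + 1)) atTop
      (𝓝 (Complex.Gamma c / (Complex.Gamma a * Complex.Gamma b))) := by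
  have h1 := (Complex.GammaSeq_tendsto_Gamma c).div
    ((Complex.GammaSeq_tendsto_Gamma a).mul (Complex.GammaSeq_tendsto_Gamma b))
    (mul_ne_zero (Complex.Gamma_ne_zero ha) (Complex.Gamma_ne_zero hb))
  have h2 : Tendsto (fun n : ℕ => (n : ℂ) / (n + 1)) atTop (𝓝 1) := by
    have := tendsto_natCast_div_add_atTop (𝕜 := ℂ) 1
    simpa using this
  have h3 := h1.mul h2
  rw [mul_one] at h3
  refine h3.congr' ?_
  filter_upwards [eventually_ge_atTop 1] with n hn
  have hn0 : (n : ℂ) ≠ 0 := by exact_mod_cast (by omega : n ≠ 0)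
  have hn1 : (n : ℂ) + 1 ≠ 0 := by exact_mod_cast n.succ_ne_zero
  have hf : ((n.factorial : ℕ) : ℂ) ≠ 0 := by exact_mod_cast n.factorial_ne_zero
  have hprod : ∀ d : ℂ, ∏ j ∈ Finset.range (n + 1), (d + j) =
      (ascPochhammer ℂ (n + 1)).eval d := by
    intro d
    generalize n + 1 = m
    induction m with
    | zero => simp
    | succ m ih => rw [Finset.prod_range_succ, ih, ascPochhammer_succ_eval]
  have hP : ∀ d : ℂ, (∀ n : ℕ, d ≠ -n) → (ascPochhammer ℂ (n + 1)).eval d ≠ 0 := by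
    intro d hd h
    rw [ascPochhammer_eval_eq_zero_iff] at h
    obtain ⟨k, -, hk⟩ := h
    exact hd k (by rw [hk, neg_neg])
  have hpa := hP a ha
  have hpb := hP b hb
  have hpc := hP c hc
  have hca : (n : ℂ) ^ a ≠ 0 := by simp [Complex.cpow_eq_zero_iff, hn0]
  have hcb : (n : ℂ) ^ b ≠ 0 := by simp [Complex.cpow_eq_zero_iff, hn0]
  have hpow : (n : ℂ) ^ a * (n : ℂ) ^ b = (n : ℂ) ^ c * n := by
    rw [← Complex.cpow_add _ _ hn0, hab, Complex.cpow_add _ _ hn0, Complex.cpow_one]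
  simp only [Pi.div_apply, Complex.GammaSeq, hprod,
    ordinaryHypergeometricCoefficient, Nat.factorial_succ, Nat.cast_mul, Nat.cast_add, Nat.cast_one]
  field_simp
  linear_combination -hpow

theorem tendsto_one_sub_sq_mul_hypergeometricDeriv {a b c : ℂ} (ha : ∀ n : ℕ, a ≠ -n)
    (hb : ∀ n : ℕ, b ≠ -n) (hc : ∀ n : ℕ, c ≠ -n) (hab : a + b = c + 1) :
    Tendsto (fun X : ℝ => (1 - (X : ℂ)) ^ 2 * hypergeometricDeriv a b c X) (𝓝[<] 1)
      (𝓝 (Complex.Gamma c / (Complex.Gamma a * Complex.Gamma b))) :=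
  tendsto_one_sub_sq_mul_tsum (tendsto_ordinaryHypergeometricCoefficient ha hb hc hab)

/-- The series itself has one order of growth less than its derivative: its coefficients are n + 1
times a null sequence. -/
theorem tendsto_one_sub_sq_mul_ordinaryHypergeometric {a b c : ℂ} (ha : ∀ n : ℕ, a ≠ -n)
    (hb : ∀ n : ℕ, b ≠ -n) (hc : ∀ n : ℕ, c ≠ -n) (hab : a + b = c + 1) :
    Tendsto (fun X : ℝ => (1 - (X : ℂ)) ^ 2 * ordinaryHypergeometric a b c (X : ℂ)) (𝓝[<] 1)
      (𝓝 0) := by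
  have h := (tendsto_add_atTop_iff_nat 1).1
    (tendsto_ordinaryHypergeometricCoefficient ha hb hc hab)
  have h1 := h.mul (tendsto_one_div_add_atTop_nhds_zero_nat (𝕜 := ℂ))
  rw [mul_zero] at h1
  refine (tendsto_one_sub_sq_mul_tsum h1).congr fun X => ?_
  rw [ordinaryHypergeometric_apply]
  congr 1
  refine tsum_congr fun n => ?_
  have hn1 : (n : ℂ) + 1 ≠ 0 := by exact_mod_cast n.succ_ne_zero
  field_simp

/-! ### Wronskians and the connection formula. -/

/-- `y`, with derivative `y₁`, solves the hypergeometric equation on `(0, 1)`. -/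
def SolvesHypergeometric (a b c : ℂ) (y y₁ : ℝ → ℂ) : Prop :=
  ∀ X ∈ Set.Ioo (0 : ℝ) 1, HasDerivAt y (y₁ X) X ∧ ∃ y₂, HasDerivAt y₁ y₂ X ∧
    (X : ℂ) * (1 - X) * y₂ + (c - (a + b + 1) * X) * y₁ X - a * b * y X = 0

/-- The Wronskian of two functions, normalised so as to be constant on the solutions of the
hypergeometric equation with `a + b = c + 1`. -/
def normWronskian (c : ℂ) (y y₁ z z₁ : ℝ → ℂ) (X : ℝ) : ℂ :=
  (X : ℂ) ^ c * (1 - (X : ℂ)) ^ 2 * (y X * z₁ X - y₁ X * z X)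

/-- Abel's identity: the Wronskian is proportional to X^(-c) (1 - X)^(c - a - b - 1), and a + b = c
+ 1 makes the second exponent -2. -/
theorem normWronskian_eq {a b c : ℂ} (hab : a + b = c + 1) {y y₁ z z₁ : ℝ → ℂ}
    (hy : SolvesHypergeometric a b c y y₁) (hz : SolvesHypergeometric a b c z z₁) {X Y : ℝ}
    (hX : X ∈ Set.Ioo (0 : ℝ) 1) (hY : Y ∈ Set.Ioo (0 : ℝ) 1) :
    normWronskian c y y₁ z z₁ X = normWronskian c y y₁ z z₁ Y := by
  have hder : ∀ X ∈ Set.Ioo (0 : ℝ) 1, HasDerivAt (normWronskian c y y₁ z z₁) 0 X := by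
    intro X hX
    obtain ⟨hy1, y2, hy2, hyo⟩ := hy X hX
    obtain ⟨hz1, z2, hz2, hzo⟩ := hz X hX
    have hX0 : (X : ℂ) ≠ 0 := by exact_mod_cast hX.1.ne'
    have hX1 : (1 - (X : ℂ)) ≠ 0 := by
      have : (1 - X) ≠ 0 := by linarith [hX.2]
      exact_mod_cast this
    have hp : HasDerivAt (fun t : ℝ => (t : ℂ) ^ c) ((X : ℂ) ^ c * (c / X)) X := by
      have h := ((hasDerivAt_id' (X : ℂ)).cpow_const (c := c)
        (Or.inl (by simpa using hX.1))).comp_ofReal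
      refine h.congr_deriv ?_
      rw [Complex.cpow_sub _ _ hX0, Complex.cpow_one]
      ring
    have hq : HasDerivAt (fun t : ℝ => ((1 - (t : ℂ)) ^ 2 : ℂ)) (-2 * (1 - (X : ℂ))) X := by
      have h := (((hasDerivAt_id' (X : ℂ)).const_sub 1).fun_pow 2).comp_ofReal
      refine h.congr_deriv ?_
      push_cast
      ring
    have h := (hp.fun_mul hq).fun_mul ((hy1.fun_mul hz2).fun_sub (hy2.fun_mul hz1))
    refine h.congr_deriv ?_
    field_simp
    have e : c = a + b - 1 := by linear_combination -hab
    generalize (X : ℂ) ^ c = p at *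
    subst e
    linear_combination p * (1 - X) * y X * hzo - p * (1 - X) * z X * hyo
  exact isOpen_Ioo.is_const_of_deriv_eq_zero isPreconnected_Ioo
    (fun X hX => (hder X hX).differentiableAt.differentiableWithinAt)
    (fun X hX => (hder X hX).deriv) hX hY

theorem normWronskian_eq_of_tendsto {a b c : ℂ} (hab : a + b = c + 1) {y y₁ z z₁ : ℝ → ℂ}
    (hy : SolvesHypergeometric a b c y y₁) (hz : SolvesHypergeometric a b c z z₁) {X : ℝ}
    (hX : X ∈ Set.Ioo (0 : ℝ) 1) {l : Filter ℝ} [l.NeBot] (hl : ∀ᶠ Y in l, Y ∈ Set.Ioo (0 : ℝ) 1)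
    {C : ℂ} (h : Tendsto (normWronskian c y y₁ z z₁) l (𝓝 C)) :
    normWronskian c y y₁ z z₁ X = C :=
  tendsto_nhds_unique (tendsto_const_nhds.congr'
    (hl.mono fun _ hY => normWronskian_eq hab hy hz hX hY)) h

theorem norm_ofReal_lt_one {X : ℝ} (hX : X ∈ Set.Ioo (0 : ℝ) 1) : ‖(X : ℂ)‖ < 1 := by
  rw [Complex.norm_real, Real.norm_of_nonneg hX.1.le]
  exact hX.2

theorem norm_one_sub_ofReal_lt_one {X : ℝ} (hX : X ∈ Set.Ioo (0 : ℝ) 1) : ‖1 - (X : ℂ)‖ < 1 := by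
  have := norm_ofReal_lt_one (X := 1 - X) ⟨by linarith [hX.2], by linarith [hX.1]⟩
  simpa using this

theorem solvesHypergeometric_zero (a b : ℂ) {c : ℂ} (hc : ∀ n : ℕ, c ≠ -n) :
    SolvesHypergeometric a b c (fun X => ordinaryHypergeometric a b c (X : ℂ))
      (fun X => hypergeometricDeriv a b c X) := fun _ hX =>
  ⟨(hasDerivAt_ordinaryHypergeometric a b hc (norm_ofReal_lt_one hX)).comp_ofReal, _,
    (hasDerivAt_hypergeometricDeriv a b hc (norm_ofReal_lt_one hX)).comp_ofReal,
    hypergeometric_ode a b hc (norm_ofReal_lt_one hX)⟩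

/-- The reflection X ↦ 1 - X preserves a and b and replaces c by a + b + 1 - c. -/
theorem solvesHypergeometric_one (a b : ℂ) {c : ℂ} (hc : ∀ n : ℕ, c ≠ -n) :
    SolvesHypergeometric a b (a + b + 1 - c) (fun X => ordinaryHypergeometric a b c (1 - X : ℂ))
      (fun X => -hypergeometricDeriv a b c (1 - X)) := by
  intro X hX
  have hw := norm_one_sub_ofReal_lt_one hX
  have h1 : HasDerivAt (fun z : ℂ => 1 - z) (-1) X := by
    simpa using (hasDerivAt_id' (X : ℂ)).const_sub 1
  refine ⟨(((hasDerivAt_ordinaryHypergeometric a b hc hw).comp (X : ℂ) h1).congr_deriv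
      (by ring)).comp_ofReal, _, ((((hasDerivAt_hypergeometricDeriv a b hc hw).comp (X : ℂ)
      h1).fun_neg).congr_deriv (by rw [mul_neg_one, neg_neg])).comp_ofReal, ?_⟩
  linear_combination hypergeometric_ode a b hc hw

theorem solvesHypergeometric_zero' (a b : ℂ) {c : ℂ} (hc : ∀ n : ℕ, 2 - c ≠ -n) :
    SolvesHypergeometric a b c
      (fun X => (X : ℂ) ^ (1 - c) *
        ordinaryHypergeometric (a - c + 1) (b - c + 1) (2 - c) (X : ℂ))
      (fun X => (X : ℂ) ^ (1 - c) * ((1 - c) / X *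
        ordinaryHypergeometric (a - c + 1) (b - c + 1) (2 - c) (X : ℂ) +
          hypergeometricDeriv (a - c + 1) (b - c + 1) (2 - c) X)) := by
  intro X hX
  have hw := norm_ofReal_lt_one hX
  have hX0 : (X : ℂ) ≠ 0 := by exact_mod_cast hX.1.ne'
  have hp : HasDerivAt (fun t : ℂ => t ^ (1 - c)) ((X : ℂ) ^ (1 - c) * ((1 - c) / X)) X := by
    refine ((hasDerivAt_id' (X : ℂ)).cpow_const (c := 1 - c)
      (Or.inl (by simpa using hX.1))).congr_deriv ?_
    rw [Complex.cpow_sub _ _ hX0, Complex.cpow_one]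
    ring
  have h0 := hasDerivAt_ordinaryHypergeometric (a - c + 1) (b - c + 1) hc hw
  have h1 := hasDerivAt_hypergeometricDeriv (a - c + 1) (b - c + 1) hc hw
  refine ⟨((hp.fun_mul h0).congr_deriv (by ring)).comp_ofReal, _, (hp.fun_mul
    ((((hasDerivAt_const (X : ℂ) (1 - c)).fun_div (hasDerivAt_id' (X : ℂ)) hX0).fun_mul
      h0).fun_add h1)).comp_ofReal, ?_⟩
  have := hypergeometric_ode (a - c + 1) (b - c + 1) hc hw
  beta_reduce
  generalize ordinaryHypergeometric (a - c + 1) (b - c + 1) (2 - c) (X : ℂ) = y at *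
  generalize hypergeometricDeriv (a - c + 1) (b - c + 1) (2 - c) (X : ℂ) = y1 at *
  generalize hypergeometricDeriv₂ (a - c + 1) (b - c + 1) (2 - c) (X : ℂ) = y2 at *
  generalize (X : ℂ) ^ (1 - c) = p at *
  field_simp
  linear_combination p * X * this

/-- The connection formula between `0` and `1` of the hypergeometric function, for `c = 2`. -/
theorem hypergeometric_connection {a b c : ℂ} (hab : a + b = c + 1) (ha : ∀ n : ℕ, a ≠ -n)
    (hb : ∀ n : ℕ, b ≠ -n) (hc : ∀ n : ℕ, c ≠ -n) (ha' : ∀ n : ℕ, a - c + 1 ≠ -n)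
    (hb' : ∀ n : ℕ, b - c + 1 ≠ -n) (hc' : ∀ n : ℕ, 2 - c ≠ -n) {X : ℝ}
    (hX : X ∈ Set.Ioo (0 : ℝ) 1) :
    (1 - c) * ordinaryHypergeometric a b 2 (1 - X : ℂ) =
      Complex.Gamma (2 - c) / (Complex.Gamma (a - c + 1) * Complex.Gamma (b - c + 1)) *
        ordinaryHypergeometric a b c (X : ℂ) -
      Complex.Gamma c / (Complex.Gamma a * Complex.Gamma b) * ((X : ℂ) ^ (1 - c) *
        ordinaryHypergeometric (a - c + 1) (b - c + 1) (2 - c) (X : ℂ)) := by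
  have h2 : ∀ n : ℕ, (2 : ℂ) ≠ -n := by
    intro n h
    have : ((2 + n : ℕ) : ℂ) = 0 := by push_cast; linear_combination h
    norm_cast at this
    omega
  have hG := solvesHypergeometric_one a b h2
  rw [show a + b + 1 - 2 = c by linear_combination hab] at hG
  have h1 := solvesHypergeometric_zero a b hc
  have hq := solvesHypergeometric_zero' a b hc'
  have hX0 : (X : ℂ) ≠ 0 := by exact_mod_cast hX.1.ne'
  have e0 : ∀ᶠ X : ℝ in 𝓝[>] 0, X ∈ Set.Ioo (0 : ℝ) 1 := Ioo_mem_nhdsGT one_pos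
  have e1 : ∀ᶠ X : ℝ in 𝓝[<] 1, X ∈ Set.Ioo (0 : ℝ) 1 := Ioo_mem_nhdsLT one_pos
  have hc0 : ∀ {a b c : ℂ}, (∀ n : ℕ, c ≠ -n) →
      ContinuousAt (ordinaryHypergeometric a b c) (0 : ℂ) := fun {a b c} hc =>
    (hasDerivAt_ordinaryHypergeometric a b hc (by simp)).continuousAt
  have hc1 : ∀ {a b c : ℂ}, (∀ n : ℕ, c ≠ -n) →
      ContinuousAt (hypergeometricDeriv a b c) (0 : ℂ) := fun {a b c} hc =>
    (hasDerivAt_hypergeometricDeriv a b hc (by simp)).continuousAt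
  have t0 : Tendsto (fun X : ℝ => (X : ℂ)) (𝓝[>] 0) (𝓝 0) := by
    have := Complex.continuous_ofReal.tendsto (0 : ℝ)
    rw [Complex.ofReal_zero] at this
    exact this.mono_left nhdsWithin_le_nhds
  have t1 : Tendsto (fun X : ℝ => (X : ℂ)) (𝓝[<] 1) (𝓝 1) := by
    have := Complex.continuous_ofReal.tendsto (1 : ℝ)
    rw [Complex.ofReal_one] at this
    exact this.mono_left nhdsWithin_le_nhds
  have t1' : Tendsto (fun X : ℝ => 1 - (X : ℂ)) (𝓝[<] 1) (𝓝 0) := by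
    simpa using t1.const_sub 1
  have tp : ∀ d : ℂ, Tendsto (fun X : ℝ => (X : ℂ) ^ d) (𝓝[<] 1) (𝓝 1) := fun d => by
    have : ContinuousAt (fun z : ℂ => z ^ d) 1 :=
      continuousAt_id.cpow continuousAt_const (by simp)
    simpa [Function.comp_def] using this.tendsto.comp t1
  -- Evaluated as X → 0: the product X^c X^(1 - c) = X cancels the pole (1 - c)/X in the derivative
  -- of the second solution, and both series tend to 1.
  have w12 := normWronskian_eq_of_tendsto hab h1 hq hX e0 (C := 1 - c) (by
    have A := (hc0 hc (a := a) (b := b)).tendsto.comp t0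
    have A1 := (hc1 hc (a := a) (b := b)).tendsto.comp t0
    have B := (hc0 hc' (a := a - c + 1) (b := b - c + 1)).tendsto.comp t0
    have B1 := (hc1 hc' (a := a - c + 1) (b := b - c + 1)).tendsto.comp t0
    have T := ((t0.const_sub 1).pow 2).mul ((A.mul ((B.const_mul (1 - c)).add (t0.mul B1))).sub
      ((A1.mul t0).mul B))
    simp only [ordinaryHypergeometric_zero] at T
    have ev : (1 - (0 : ℂ)) ^ 2 * (1 * ((1 - c) * 1 + 0 *
      hypergeometricDeriv (a - c + 1) (b - c + 1) (2 - c) 0) -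
      hypergeometricDeriv a b c 0 * 0 * 1) = 1 - c := by ring
    rw [ev] at T
    refine T.congr' ?_
    filter_upwards [e0] with Y hY
    have hY0 : (Y : ℂ) ≠ 0 := by exact_mod_cast hY.1.ne'
    have hp : (Y : ℂ) ^ c * (Y : ℂ) ^ (1 - c) = Y := by
      rw [← Complex.cpow_add _ _ hY0, add_sub_cancel, Complex.cpow_one]
    simp only [normWronskian, Function.comp]
    generalize (Y : ℂ) ^ c = p at *
    generalize (Y : ℂ) ^ (1 - c) = q at *
    have hq : q = Y / p := by
      have : p ≠ 0 := fun h => hY0 (by rw [← hp, h, zero_mul])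
      field_simp
      linear_combination hp
    have hp0 : p ≠ 0 := fun h => hY0 (by rw [← hp, h, zero_mul])
    subst hq
    field_simp)
  have gG := ((hc0 h2 (a := a) (b := b)).tendsto.comp t1')
  have gG1 := ((hc1 h2 (a := a) (b := b)).tendsto.comp t1')
  -- Evaluated as X → 1: the solution regular at 1 tends to 1 and its derivative stays bounded, so
  -- only the blow-up of the other derivative survives the factor (1 - X)².
  have wG1 := normWronskian_eq_of_tendsto hab hG h1 hX e1
    (C := Complex.Gamma c / (Complex.Gamma a * Complex.Gamma b)) (by
    have T := (tp c).mul ((gG.mul (tendsto_one_sub_sq_mul_hypergeometricDeriv ha hb hc hab)).add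
      (gG1.mul (tendsto_one_sub_sq_mul_ordinaryHypergeometric ha hb hc hab)))
    rw [ordinaryHypergeometric_zero, one_mul, one_mul, mul_zero, add_zero] at T
    refine T.congr fun Y => ?_
    simp only [normWronskian, Function.comp]
    ring)
  have wG2 := normWronskian_eq_of_tendsto hab hG hq hX e1
    (C := Complex.Gamma (2 - c) / (Complex.Gamma (a - c + 1) * Complex.Gamma (b - c + 1))) (by
    have hab' : a - c + 1 + (b - c + 1) = 2 - c + 1 := by linear_combination hab
    have D1 := tendsto_one_sub_sq_mul_hypergeometricDeriv ha' hb' hc' hab'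
    have D0 := tendsto_one_sub_sq_mul_ordinaryHypergeometric ha' hb' hc' hab'
    have T := ((tp c).mul (tp (1 - c))).mul ((gG.mul
      ((((tendsto_const_nhds (x := 1 - c)).div t1 one_ne_zero).mul D0).add D1)).add (gG1.mul D0))
    rw [ordinaryHypergeometric_zero, one_mul, one_mul, mul_zero, mul_zero, add_zero, zero_add,
      one_mul] at T
    refine T.congr fun Y => ?_
    simp only [normWronskian, Function.comp, Pi.div_apply]
    ring)
  simp only [normWronskian] at w12 wG1 wG2
  generalize (X : ℂ) ^ (1 - c) = q at *
  -- The identity G·W(y, z) = y·W(G, z) - z·W(G, y) for the three solutions; the factor X^c (1 - X)²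
  -- is already contained in the Wronskian values.
  linear_combination (-ordinaryHypergeometric a b 2 (1 - X : ℂ)) * w12 +
    ordinaryHypergeometric a b c (X : ℂ) * wG2 -
    q * ordinaryHypergeometric (a - c + 1) (b - c + 1) (2 - c) (X : ℂ) * wG1

/-! ### The kernel K as a Gauss series in 1/σ. -/

theorem quarter_cpow_mul_two_cpow (s : ℂ) :
    (1 / 4 : ℂ) ^ (s - 1) * (2 : ℂ) ^ (2 * s - 2) = 1 := by
  have e : (1 / 4 : ℂ) = (4 : ℂ)⁻¹ := by norm_num
  have h4 : (4 : ℂ) ^ (s - 1) = (2 : ℂ) ^ (2 * s - 2) := by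
    have h := Complex.mul_cpow_ofReal_nonneg (a := 2) (b := 2) (by norm_num) (by norm_num) (s - 1)
    push_cast at h
    rw [show (2 : ℂ) * 2 = 4 by norm_num, ← Complex.cpow_add _ _ two_ne_zero] at h
    rw [h]
    ring_nf
  rw [e, Complex.inv_cpow, h4, inv_mul_cancel₀]
  · simp [Complex.cpow_eq_zero_iff]
  · rw [Ne, Complex.arg_eq_pi_iff]
    norm_num

theorem pi_rpow_mul_sqrt_pi : Real.pi ^ (3 / 2 : ℝ) * √Real.pi = Real.pi ^ 2 := by
  rw [Real.sqrt_eq_rpow, ← Real.rpow_add Real.pi_pos, ← Real.rpow_natCast]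
  norm_num

/-- The constant factor of `pairKernel`. -/
def pairCoeff (k : ℤ) (s : ℂ) : ℂ :=
  ((Real.pi ^ (3 / 2 : ℝ) : ℝ) : ℂ) * Complex.Gamma (3 / 2 - s) /
      ((((|k| : ℤ) : ℂ) + 1 - s) * Complex.Gamma (2 - s)) * (1 / 4 : ℂ) ^ (s - 1)

/-- Legendre duplication for Γ(3/2 - s)Γ(2 - s); the powers of 2 and 4 cancel and the √π completes
π^(3/2) to π². -/
theorem pairCoeff_eq {k : ℤ} {s : ℂ} (hs : ∀ n : ℕ, 2 - s ≠ -n) :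
    pairCoeff k s = Real.pi ^ 2 * Complex.Gamma (3 - 2 * s) /
      ((((|k| : ℤ) : ℂ) + 1 - s) * Complex.Gamma (2 - s) ^ 2) := by
  have hG := Complex.Gamma_ne_zero hs
  have hd := Complex.Gamma_mul_Gamma_add_half (3 / 2 - s)
  rw [show 3 / 2 - s + 1 / 2 = 2 - s by ring, show 2 * (3 / 2 - s) = 3 - 2 * s by ring,
    show 1 - (3 - 2 * s) = 2 * s - 2 by ring] at hd
  have h2 := quarter_cpow_mul_two_cpow s
  have hpi : ((Real.pi ^ (3 / 2 : ℝ) : ℝ) : ℂ) * (√Real.pi : ℝ) = (Real.pi : ℂ) ^ 2 := by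
    exact_mod_cast congrArg (fun x : ℝ => (x : ℂ)) pi_rpow_mul_sqrt_pi
  have hG' : Complex.Gamma (3 / 2 - s) =
      Complex.Gamma (3 - 2 * s) * 2 ^ (2 * s - 2) * (√Real.pi : ℝ) / Complex.Gamma (2 - s) := by
    rw [eq_div_iff hG, hd]
  rw [pairCoeff, hG', ← hpi]
  generalize ((|k| : ℤ) : ℂ) + 1 - s = d
  rw [show ∀ p g t r G q : ℂ, p * (g * t * r / G) / (d * G) * q =
    (q * t) * (p * r * g / (d * G ^ 2)) from fun p g t r G q => by ring, h2, one_mul]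

/-- The coefficient of the connection formula. -/
theorem pairCoeff_mul {k : ℤ} (hk : k = 0 ∨ k = 1) {s : ℂ} (hs : ∀ n : ℕ, 2 - s ≠ -n)
    (hs1 : s ≠ 1) :
    (2 - 2 * s) * pairCoeff k s = 2 * Real.pi ^ 2 * (Complex.Gamma (3 - 2 * s) /
      (Complex.Gamma (2 - s - k) * Complex.Gamma (2 - s + k))) := by
  have hG := Complex.Gamma_ne_zero hs
  have h1 : 1 - s ≠ 0 := sub_ne_zero.2 hs1.symm
  have h2 : 2 - s ≠ 0 := by simpa using hs 0
  rw [pairCoeff_eq hs]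
  -- For k = 0 the denominator 1 - s cancels against 2 - 2s. For k = 1 it is 2 - s, and Γ(1 - s)Γ(3
  -- - s) = Γ(2 - s)²(2 - s)/(1 - s).
  rcases hk with rfl | rfl
  · have h1' : (0 : ℂ) + 1 - s ≠ 0 := by simpa using h1
    simp only [abs_zero, Int.cast_zero, sub_zero, add_zero]
    field_simp
    ring
  · have h2' : (1 : ℂ) + 1 - s ≠ 0 := by convert h2 using 1; ring
    have e1 : Complex.Gamma (2 - s) = (1 - s) * Complex.Gamma (1 - s) := by
      rw [← Complex.Gamma_add_one _ h1]
      ring_nf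
    have e2 : Complex.Gamma (3 - s) = (2 - s) * Complex.Gamma (2 - s) := by
      rw [← Complex.Gamma_add_one _ h2]
      ring_nf
    have hG1 : Complex.Gamma (1 - s) ≠ 0 := by
      intro h
      rw [e1, h, mul_zero] at hG
      exact hG rfl
    simp only [abs_one, Int.cast_one]
    rw [show 2 - s - 1 = 1 - s by ring, show 2 - s + 1 = 3 - s by ring, e2, e1]
    rw [show (1 : ℂ) + 1 - s = 2 - s by ring]
    field_simp

theorem ordinaryHypergeometric_zero_left (b c x : ℂ) : ordinaryHypergeometric 0 b c x = 1 := by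
  rw [ordinaryHypergeometric_apply, tsum_eq_single 0]
  · simp [ordinaryHypergeometricCoefficient]
  · intro n hn
    rw [ordinaryHypergeometricCoefficient, (ascPochhammer_eval_eq_zero_iff n _).2
      ⟨0, Nat.pos_of_ne_zero hn, by simp⟩]
    simp

/-- Pfaff at z = -1/(σ - 1): here 1 - z = σ/(σ - 1) and z/(z - 1) = 1/σ, so the powers of σ - 1
cancel and those of σ combine to σ^(-s). -/
theorem pairKernel_eq {Z Z' : ℂ × ℂ} (hσ : 1 < sigma Z Z') {k : ℤ} (hk : k = 0 ∨ k = 1) {s : ℂ}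
    (hs : ∀ n : ℕ, 2 * s - 1 ≠ -n) :
    pairKernel Z Z' k s = rho Z Z' ^ k * rho (star Z) (star Z') ^ (-k) * (pairCoeff k s *
      (((sigma Z Z')⁻¹ : ℝ) : ℂ) ^ s *
        ordinaryHypergeometric (s - k) (s + k) (2 * s - 1) (((sigma Z Z')⁻¹ : ℝ) : ℂ)) := by
  have habs : |k| = k := by rcases hk with rfl | rfl <;> simp
  rw [pairKernel, pairCoeff, habs]
  generalize sigma Z Z' = σ at *
  have hσ0 : 0 < σ := by linarith
  have hσ1 : 0 < σ - 1 := by linarith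
  have hc0 : (σ : ℂ) ≠ 0 := by exact_mod_cast hσ0.ne'
  have hc1 : ((σ - 1 : ℝ) : ℂ) ≠ 0 := by exact_mod_cast hσ1.ne'
  have hz : (-1 / ((σ - 1 : ℝ) : ℂ)).re < 1 / 2 := by
    have : -1 / ((σ - 1 : ℝ) : ℂ) = ((-1 / (σ - 1) : ℝ) : ℂ) := by push_cast; rfl
    rw [this, Complex.ofReal_re]
    have : -1 / (σ - 1) < 0 := div_neg_of_neg_of_pos (by norm_num) hσ1
    linarith
  rw [gaussF_eq_pfaff _ _ hs hz, pfaff]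
  have e1 : 1 - -1 / ((σ - 1 : ℝ) : ℂ) = ((σ / (σ - 1) : ℝ) : ℂ) := by
    push_cast at hc1 ⊢
    field_simp
    ring
  have e2 : -1 / ((σ - 1 : ℝ) : ℂ) / (-1 / ((σ - 1 : ℝ) : ℂ) - 1) = ((σ⁻¹ : ℝ) : ℂ) := by
    have : -1 / ((σ - 1 : ℝ) : ℂ) - 1 = -(σ / ((σ - 1 : ℝ) : ℂ)) := by
      push_cast at hc1 ⊢
      field_simp
      ring
    rw [this]
    push_cast at hc1 ⊢
    field_simp
  rw [e1, e2, show 2 * s - 1 - (s - 1 - (k : ℂ)) = s + k by ring]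
  have e3 : ((σ - 1 : ℝ) : ℂ) ^ ((k : ℂ) - s) * ((σ / (σ - 1) : ℝ) : ℂ) ^ (-(s - k)) =
      (σ : ℂ) ^ ((k : ℂ) - s) := by
    rw [neg_sub, ← Complex.mul_cpow_ofReal_nonneg hσ1.le (by positivity), ← Complex.ofReal_mul,
      mul_div_cancel₀ _ hσ1.ne']
  have e4 : (σ : ℂ) ^ (-k) * (σ : ℂ) ^ ((k : ℂ) - s) = ((σ⁻¹ : ℝ) : ℂ) ^ s := by
    rw [← Complex.cpow_intCast, ← Complex.cpow_add _ _ hc0, Complex.ofReal_inv,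
      Complex.inv_cpow _ _ (by rw [Complex.arg_ofReal_of_nonneg hσ0.le]; exact Real.pi_pos.ne),
      ← Complex.cpow_neg]
    congr 1
    push_cast
    ring
  rw [← e4, ← e3]
  ring

/-- The connection formula with a = s - k, b = s + k, c = 2s - 1, X = 1/σ. The companion solution at
0 has the same parameters with 2 - s for s, and X^s X^(1 - c) = X^(2 - s). -/
theorem pairKernel_add_pairKernel {Z Z' : ℂ × ℂ} (hσ : 1 < sigma Z Z') {k : ℤ}
    (hk : k = 0 ∨ k = 1) {s : ℂ} (hs₁ : ∀ n : ℕ, 2 * s - 1 ≠ -(n : ℂ))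
    (hs₂ : ∀ n : ℕ, 2 * (2 - s) - 1 ≠ -(n : ℂ)) (hs₃ : k = 0 → s ≠ 1) :
    pairKernel Z Z' k s + pairKernel Z Z' k (2 - s) =
      rho Z Z' ^ k * rho (star Z) (star Z') ^ (-k) * (2 * Real.pi ^ 2 *
        (((sigma Z Z')⁻¹ : ℝ) : ℂ) ^ s *
          ordinaryHypergeometric (s - k) (s + k) 2 (1 - ((sigma Z Z')⁻¹ : ℝ) : ℂ)) := by
  rw [pairKernel_eq hσ hk hs₁, pairKernel_eq hσ hk hs₂, ← mul_add]
  congr 1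
  have hX : (sigma Z Z')⁻¹ ∈ Set.Ioo (0 : ℝ) 1 :=
    ⟨inv_pos.2 (by linarith), inv_lt_one_of_one_lt₀ hσ⟩
  generalize (sigma Z Z')⁻¹ = X at *
  have hX0 : (X : ℂ) ≠ 0 := by exact_mod_cast hX.1.ne'
  have A1 : ∀ n : ℕ, 2 - s ≠ -n := fun n h => hs₂ (2 * n + 1) (by
    push_cast
    linear_combination 2 * h)
  have A2 : ∀ n : ℕ, 2 - (2 - s) ≠ -n := fun n h => hs₁ (2 * n + 1) (by
    push_cast
    linear_combination 2 * h)
  -- At s = 1 the connection formula degenerates, since 1 - c = 0. Only k = 1 is left; then a = 0,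
  -- both series are constantly 1, and each kernel has the constant π².
  by_cases h1 : s = 1
  · obtain rfl : k = 1 := hk.resolve_left fun h => hs₃ h h1
    subst h1
    have hz : (1 : ℂ) - ((1 : ℤ) : ℂ) = 0 := by simp
    rw [pairCoeff_eq A1, pairCoeff_eq A2, show (2 : ℂ) - 1 = 1 by norm_num, hz,
      ordinaryHypergeometric_zero_left, ordinaryHypergeometric_zero_left]
    norm_num
    ring
  · have B1 := pairCoeff_mul hk A1 h1
    have B2 := pairCoeff_mul hk A2 (fun h => h1 (by linear_combination -h))
    have h1' : 2 - 2 * s ≠ 0 := fun h => h1 (by linear_combination -h / 2)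
    -- If t - k or t + k were a nonpositive integer, then 2t - 1 would be a negative odd integer;
    -- the one exception is t = 1, k = 1.
    have hneg : ∀ {t : ℂ}, (∀ n : ℕ, 2 * t - 1 ≠ -(n : ℂ)) → t ≠ 1 →
        (∀ n : ℕ, t - k ≠ -n) ∧ ∀ n : ℕ, t + k ≠ -n := by
      intro t ht ht1
      refine ⟨fun n h => ?_, fun n h => ?_⟩
      · rcases hk with rfl | rfl
        · refine ht (2 * n + 1) ?_
          push_cast at h ⊢
          linear_combination 2 * h
        · rcases n with _ | n
          · exact ht1 (by push_cast at h; linear_combination h)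
          · refine ht (2 * n + 1) ?_
            push_cast at h ⊢
            linear_combination 2 * h
      · rcases hk with rfl | rfl
        · refine ht (2 * n + 1) ?_
          push_cast at h ⊢
          linear_combination 2 * h
        · refine ht (2 * n + 3) ?_
          push_cast at h ⊢
          linear_combination 2 * h
    obtain ⟨ha, hb⟩ := hneg hs₁ h1
    obtain ⟨ha', hb'⟩ := hneg hs₂ (fun h => h1 (by linear_combination -h))
    have ea : s - k - (2 * s - 1) + 1 = 2 - s - k := by ring
    have eb : s + k - (2 * s - 1) + 1 = 2 - s + k := by ring
    have ec : 2 - (2 * s - 1) = 2 * (2 - s) - 1 := by ring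
    have C := hypergeometric_connection (a := s - k) (b := s + k) (c := 2 * s - 1) (by ring) ha hb
      hs₁ (by rwa [ea]) (by rwa [eb]) (by rwa [ec]) hX
    rw [ea, eb, ec] at C
    have hp : (X : ℂ) ^ (2 - s) = (X : ℂ) ^ s * (X : ℂ) ^ (1 - (2 * s - 1)) := by
      rw [← Complex.cpow_add _ _ hX0]
      congr 1
      ring
    rw [show 3 - 2 * s = 2 * (2 - s) - 1 by ring] at B1
    rw [show 3 - 2 * (2 - s) = 2 * s - 1 by ring, show 2 - (2 - s) = s by ring] at B2
    rw [hp]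
    refine mul_left_cancel₀ h1' ?_
    generalize (X : ℂ) ^ (1 - (2 * s - 1)) = q at *
    generalize ordinaryHypergeometric (s - k) (s + k) 2 (1 - X : ℂ) = G at *
    generalize ordinaryHypergeometric (s - k) (s + k) (2 * s - 1) (X : ℂ) = f₁ at *
    generalize ordinaryHypergeometric (2 - s - k) (2 - s + k) (2 * (2 - s) - 1) (X : ℂ) = f₂ at *
    linear_combination (X : ℂ) ^ s * f₁ * B1 - (X : ℂ) ^ s * q * f₂ * B2 -
      2 * Real.pi ^ 2 * (X : ℂ) ^ s * C

/-! ### Angular, radial and disc integrals of monomials. -/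

open scoped ComplexConjugate Nat

theorem integral_cexp_int_mul_I (n : ℤ) :
    ∫ θ in Set.Ioo (-Real.pi) Real.pi, Complex.exp (n * θ * Complex.I) =
      if n = 0 then 2 * (Real.pi : ℂ) else 0 := by
  rw [← integral_Ioc_eq_integral_Ioo,
    ← intervalIntegral.integral_of_le (by linarith [Real.pi_pos])]
  split_ifs with h
  · subst h
    simp
    ring
  · have hc : (n : ℂ) * Complex.I ≠ 0 := by simp [h]
    have := integral_exp_mul_complex (a := -Real.pi) (b := Real.pi) hc
    simp_rw [mul_right_comm (n : ℂ) _ Complex.I, this]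
    have e : Complex.exp (n * Complex.I * (Real.pi : ℝ)) =
        Complex.exp (n * Complex.I * ((-Real.pi : ℝ) : ℂ)) := by
      rw [Complex.exp_eq_exp_iff_exists_int]
      exact ⟨n, by push_cast; ring⟩
    rw [e, sub_self, zero_div]

/-- Integration in polar coordinates of a monomial times a radial function. -/
theorem integral_pow_mul_conj_pow_mul_radial (b d : ℕ) (G : ℝ → ℂ) :
    ∫ w : ℂ, w ^ b * conj w ^ d * G (‖w‖ ^ 2) =
      if b = d then Real.pi * ∫ y in Set.Ioi (0 : ℝ), (y : ℂ) ^ b * G y else 0 := by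
  rw [← Complex.integral_comp_polarCoord_symm]
  have e : ∀ p ∈ polarCoord.target, p.1 • ((Complex.polarCoord.symm p) ^ b *
      conj (Complex.polarCoord.symm p) ^ d * G (‖Complex.polarCoord.symm p‖ ^ 2)) =
      ((p.1 : ℂ) ^ (b + d + 1) * G (p.1 ^ 2)) *
        Complex.exp (((b : ℤ) - (d : ℤ) : ℤ) * p.2 * Complex.I) := by
    rintro ⟨r, θ⟩ -
    have h1 : Complex.polarCoord.symm (r, θ) = r * Complex.exp (θ * Complex.I) := by
      rw [Complex.polarCoord_symm_apply, Complex.exp_mul_I]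
      simp
    have h2 : conj (Complex.polarCoord.symm (r, θ)) = r * Complex.exp (-(θ * Complex.I)) := by
      rw [h1, map_mul, Complex.conj_ofReal, ← Complex.exp_conj, map_mul, Complex.conj_ofReal,
        Complex.conj_I, mul_neg]
    have h3 : Complex.exp (((b : ℤ) - (d : ℤ) : ℤ) * θ * Complex.I) =
        Complex.exp (θ * Complex.I) ^ b * Complex.exp (-(θ * Complex.I)) ^ d := by
      rw [← Complex.exp_nat_mul, ← Complex.exp_nat_mul, ← Complex.exp_add]
      congr 1
      push_cast
      ring
    rw [Complex.norm_polarCoord_symm, sq_abs, h2, h1, h3, Complex.real_smul, mul_pow, mul_pow]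
    ring
  rw [setIntegral_congr_fun polarCoord.open_target.measurableSet e, polarCoord_target,
    Measure.volume_eq_prod,
    setIntegral_prod_mul (fun r : ℝ => (r : ℂ) ^ (b + d + 1) * G (r ^ 2))
      (fun θ : ℝ => Complex.exp (((b : ℤ) - (d : ℤ) : ℤ) * θ * Complex.I)),
    integral_cexp_int_mul_I]
  by_cases h : b = d
  · subst h
    rw [if_pos (sub_self _), if_pos rfl]
    have := integral_comp_rpow_Ioi (fun y : ℝ => (y : ℂ) ^ b * G y) (p := 2) two_ne_zero
    rw [← this, ← integral_mul_const, ← integral_const_mul]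
    refine setIntegral_congr_fun measurableSet_Ioi fun r _ => ?_
    have e1 : (2 : ℝ) - 1 = 1 := by norm_num
    rw [e1, Real.rpow_one, Complex.real_smul, Real.rpow_two]
    push_cast
    rw [abs_two]
    push_cast
    ring
  · rw [if_neg, if_neg h, mul_zero]
    rw [sub_eq_zero]
    exact_mod_cast h

theorem integral_pow_mul_one_sub_pow (a b : ℕ) :
    ∫ y in Set.Ioi (0 : ℝ), (y : ℂ) ^ a * (if y < 1 then (1 - (y : ℂ)) ^ b else 0) =
      a ! * b ! / (a + b + 1)! := by
  have h1 : ∫ y in Set.Ioi (0 : ℝ), (y : ℂ) ^ a * (if y < 1 then (1 - (y : ℂ)) ^ b else 0) =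
      Complex.betaIntegral (a + 1) (b + 1) := by
    rw [Complex.betaIntegral, intervalIntegral.integral_of_le zero_le_one,
      integral_Ioc_eq_integral_Ioo]
    rw [show Set.Ioo (0 : ℝ) 1 = Set.Iio 1 ∩ Set.Ioi 0 by
      rw [Set.inter_comm, Set.Ioi_inter_Iio], ← Measure.restrict_restrict measurableSet_Iio,
      ← integral_indicator measurableSet_Iio]
    refine integral_congr_ae (Eventually.of_forall fun y => ?_)
    by_cases hy : y < 1
    · rw [Set.indicator_of_mem (by exact hy)]
      simp [hy]
    · rw [Set.indicator_of_notMem (by exact hy)]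
      simp [hy]
  have hprod : ∀ n : ℕ, (a ! : ℂ) * ∏ j ∈ Finset.range n, ((a : ℂ) + 1 + j) = (a + n)! := by
    intro n
    induction n with
    | zero => simp
    | succ n ih =>
      rw [Finset.prod_range_succ, ← mul_assoc, ih, ← add_assoc, Nat.factorial_succ]
      push_cast
      ring
  have hu : 0 < ((a : ℂ) + 1).re := by
    simp
    positivity
  rw [h1, Complex.betaIntegral_eval_nat_add_one_right hu]
  have ha : (a ! : ℂ) ≠ 0 := by exact_mod_cast a.factorial_ne_zero
  rw [show a + b + 1 = a + (b + 1) by ring, ← hprod, mul_div_mul_left _ _ ha]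

theorem integral_ball_pow_mul_conj_pow (a b c : ℕ) :
    ∫ z in Metric.ball (0 : ℂ) 1, z ^ a * conj z ^ c * (1 - (‖z‖ : ℂ) ^ 2) ^ b =
      if a = c then (Real.pi : ℂ) * (a ! * b ! / (a + b + 1)!) else 0 := by
  rw [← integral_indicator Metric.isOpen_ball.measurableSet, ← integral_pow_mul_one_sub_pow,
    ← integral_pow_mul_conj_pow_mul_radial]
  refine integral_congr_ae (Eventually.of_forall fun z => ?_)
  by_cases hz : ‖z‖ < 1
  · have h2 : ‖z‖ ^ 2 < 1 := by
      have := norm_nonneg z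
      nlinarith
    simp [Set.indicator, hz, h2]
  · have h2 : ¬ ‖z‖ ^ 2 < 1 := by
      push Not at hz ⊢
      nlinarith
    simp [Set.indicator, hz, h2]

/-! ### The Cayley transform and its change of variables. -/

/-- The Cayley transform of the right half plane onto the unit disc taking `h / 2` to `0`. -/
def cayley (h : ℝ) (z : ℂ) : ℂ := 1 - h / (z + h / 2)

section

variable {h : ℝ} (hh : 0 < h)

include hh

theorem add_half_ne_zero {z : ℂ} (hz : 0 ≤ z.re) : z + h / 2 ≠ 0 := by
  intro e
  have := congrArg Complex.re e
  simp at this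
  linarith

theorem one_sub_norm_cayley_sq {z : ℂ} (hz : 0 ≤ z.re) :
    1 - ‖cayley h z‖ ^ 2 = 2 * z.re * h / ‖z + h / 2‖ ^ 2 := by
  have h0 := add_half_ne_zero hh hz
  have h1 : cayley h z = (z - h / 2) / (z + h / 2) := by
    rw [cayley, eq_div_iff h0, sub_mul, div_mul_cancel₀ _ h0]
    ring
  have h2 : ‖z + h / 2‖ ≠ 0 := norm_ne_zero_iff.2 h0
  rw [h1, norm_div, div_pow, eq_div_iff (pow_ne_zero 2 h2), sub_mul,
    div_mul_cancel₀ _ (pow_ne_zero 2 h2),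
    ← Complex.normSq_eq_norm_sq, ← Complex.normSq_eq_norm_sq, Complex.normSq_apply,
    Complex.normSq_apply]
  simp
  ring

theorem cayley_image : cayley h '' {z | 0 < z.re} = Metric.ball 0 1 := by
  ext u
  constructor
  · rintro ⟨z, hz, rfl⟩
    have hz' : 0 < z.re := hz
    have := one_sub_norm_cayley_sq hh hz'.le
    have h0 : 0 < ‖z + h / 2‖ := norm_pos_iff.2 (add_half_ne_zero hh hz'.le)
    have h2 : 0 < 1 - ‖cayley h z‖ ^ 2 := by rw [this]; positivity
    rw [mem_ball_zero_iff]
    nlinarith [norm_nonneg (cayley h z)]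
  · intro hu
    rw [mem_ball_zero_iff] at hu
    have h1 : 1 - u ≠ 0 := by
      intro e
      rw [sub_eq_zero] at e
      rw [← e, norm_one] at hu
      exact lt_irrefl _ hu
    have hh' : (h : ℂ) ≠ 0 := by exact_mod_cast hh.ne'
    refine ⟨h / (1 - u) - h / 2, ?_, ?_⟩
    · have h2 : 0 < Complex.normSq (1 - u) := Complex.normSq_pos.2 h1
      have h3 : ‖u‖ ^ 2 < 1 := by nlinarith [norm_nonneg u]
      rw [← Complex.normSq_eq_norm_sq] at h3
      have : ((h : ℂ) / (1 - u) - h / 2).re =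
          h * (1 - Complex.normSq u) / (2 * Complex.normSq (1 - u)) := by
        have e : ((h : ℂ) / (1 - u) - h / 2) = ((h : ℝ) : ℂ) * (1 - u)⁻¹ - ((h / 2 : ℝ) : ℂ) := by
          push_cast
          ring
        rw [e, Complex.sub_re, Complex.re_ofReal_mul, Complex.inv_re, Complex.ofReal_re]
        field_simp
        simp only [Complex.normSq_apply, Complex.sub_re, Complex.sub_im, Complex.one_re,
          Complex.one_im]
        ring
      rw [Set.mem_ofPred_eq, this]
      have : 0 < 1 - Complex.normSq u := by linarith
      positivity
    · rw [cayley, sub_add_cancel, div_div_cancel₀ hh', sub_sub_cancel]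

theorem cayley_injOn : Set.InjOn (cayley h) {z | 0 < z.re} := by
  intro z hz z' hz' e
  have h1 := add_half_ne_zero hh (le_of_lt hz)
  have h2 := add_half_ne_zero hh (le_of_lt hz')
  have hh' : (h : ℂ) ≠ 0 := by exact_mod_cast hh.ne'
  rw [cayley, cayley, sub_right_inj, div_eq_div_iff h1 h2] at e
  have := mul_left_cancel₀ hh' e
  linear_combination -this

theorem hasFDerivWithinAt_cayley {z : ℂ} (hz : 0 < z.re) (s : Set ℂ) :
    HasFDerivWithinAt (cayley h)
      ((ContinuousLinearMap.toSpanSingleton ℂ ((h : ℂ) / (z + h / 2) ^ 2)).restrictScalars ℝ) s z := by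
  have h1 := add_half_ne_zero hh hz.le
  have hd : HasDerivAt (cayley h) ((h : ℂ) / (z + h / 2) ^ 2) z := by
    refine (((hasDerivAt_const z (h : ℂ)).fun_div ((hasDerivAt_id' z).add_const _) h1).const_sub
      1).congr_deriv ?_
    ring
  exact (hd.hasFDerivAt.restrictScalars ℝ).hasFDerivWithinAt

end

/-- As a real linear map, multiplication by c has determinant the norm of c from ℂ to ℝ. -/
theorem abs_det_toSpanSingleton (c : ℂ) :
    |((ContinuousLinearMap.toSpanSingleton ℂ c).restrictScalars ℝ).det| = ‖c‖ ^ 2 := by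
  have : ((ContinuousLinearMap.toSpanSingleton ℂ c).restrictScalars ℝ).det = ‖c‖ ^ 2 := by
    rw [ContinuousLinearMap.det]
    have : ((ContinuousLinearMap.toSpanSingleton ℂ c).restrictScalars ℝ : ℂ →ₗ[ℝ] ℂ) =
        LinearMap.mul ℝ ℂ c := by
      ext; simp [mul_comm]
    rw [this, ← Complex.normSq_eq_norm_sq, ← Algebra.norm_complex_apply, Algebra.norm_apply]
    rfl
  rw [this, abs_of_nonneg (by positivity)]

/-- The density `h² / |z + h/2|⁴`, the Jacobian of the Cayley transform. -/
def cayleyDensity (h : ℝ) (z : ℂ) : ℝ := h ^ 2 / ‖z + h / 2‖ ^ 4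

theorem cayleyDensity_nonneg (h : ℝ) (z : ℂ) : 0 ≤ cayleyDensity h z := by
  unfold cayleyDensity
  positivity

theorem measurable_cayley (h : ℝ) : Measurable (cayley h) := by
  unfold cayley
  fun_prop

theorem measurable_cayleyDensity (h : ℝ) : Measurable (cayleyDensity h) := by
  unfold cayleyDensity
  fun_prop

theorem measurableSet_re_pos : MeasurableSet {z : ℂ | 0 < z.re} :=
  measurableSet_lt measurable_const Complex.measurable_re

section

variable {h : ℝ} (hh : 0 < h)

include hh

/-- Change of variables in the Cayley transform. -/
theorem setIntegral_comp_cayley (g : ℂ → ℂ) :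
    ∫ z in {z : ℂ | 0 < z.re}, g (cayley h z) * cayleyDensity h z =
      ∫ u in Metric.ball (0 : ℂ) 1, g u := by
  rw [← cayley_image hh, integral_image_eq_integral_abs_det_fderiv_smul volume measurableSet_re_pos
    (fun z hz => hasFDerivWithinAt_cayley hh hz _) (cayley_injOn hh)]
  refine setIntegral_congr_fun measurableSet_re_pos fun z hz => ?_
  simp only [abs_det_toSpanSingleton, Complex.real_smul, cayleyDensity, norm_div, norm_pow,
    Complex.norm_real, Real.norm_of_nonneg hh.le]
  rw [mul_comm, div_pow, ← pow_mul]

theorem integrableOn_comp_cayley {g : ℂ → ℂ} (hg : IntegrableOn g (Metric.ball 0 1)) :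
    IntegrableOn (fun z => g (cayley h z) * cayleyDensity h z) {z : ℂ | 0 < z.re} := by
  rw [← cayley_image hh, integrableOn_image_iff_integrableOn_abs_det_fderiv_smul volume
    measurableSet_re_pos (fun z hz => hasFDerivWithinAt_cayley hh hz _) (cayley_injOn hh)] at hg
  refine hg.congr_fun (fun z hz => ?_) measurableSet_re_pos
  simp only [abs_det_toSpanSingleton, Complex.real_smul, cayleyDensity, norm_div, norm_pow,
    Complex.norm_real, Real.norm_of_nonneg hh.le]
  rw [mul_comm, div_pow, ← pow_mul]

end

/-! ### The boundary as the unit sphere, and the moments of its measure. -/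

/-- The first boundary coordinate of the point with coordinates `(w, v)`. -/
def boundaryFst (p : ℂ × ℝ) : ℂ := ((‖p.1‖ ^ 2 / 2 : ℝ) : ℂ) + Complex.I * p.2

theorem boundaryFst_re (p : ℂ × ℝ) : (boundaryFst p).re = ‖p.1‖ ^ 2 / 2 := by
  simp [boundaryFst, -Complex.ofReal_pow, -Complex.ofReal_div]

theorem boundaryFst_im (p : ℂ × ℝ) : (boundaryFst p).im = p.2 := by
  simp [boundaryFst, -Complex.ofReal_pow, -Complex.ofReal_div]

theorem boundaryFst_re_nonneg (p : ℂ × ℝ) : 0 ≤ (boundaryFst p).re := by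
  rw [boundaryFst_re]
  positivity

theorem measurable_boundaryFst : Measurable boundaryFst := by
  unfold boundaryFst
  fun_prop

/-- The first coordinate on the unit sphere of the boundary point `(w, v)`. -/
def sphereFst (h : ℝ) (p : ℂ × ℝ) : ℂ := cayley h (boundaryFst p)

/-- The second coordinate on the unit sphere of the boundary point `(w, v)`. -/
def sphereSnd (h : ℝ) (p : ℂ × ℝ) : ℂ := √h * p.1 / (boundaryFst p + h / 2)

/-- The density on the boundary of the measure of the unit sphere. -/
def sphereDensity (h : ℝ) (p : ℂ × ℝ) : ℝ := cayleyDensity h (boundaryFst p)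

theorem measurable_sphereFst (h : ℝ) : Measurable (sphereFst h) :=
  (measurable_cayley h).comp measurable_boundaryFst

theorem measurable_sphereSnd (h : ℝ) : Measurable (sphereSnd h) := by
  have := measurable_boundaryFst
  unfold sphereSnd
  fun_prop

theorem measurable_sphereDensity (h : ℝ) : Measurable (sphereDensity h) :=
  (measurable_cayleyDensity h).comp measurable_boundaryFst

theorem norm_sphereFst_sq_add {h : ℝ} (hh : 0 < h) (p : ℂ × ℝ) :
    ‖sphereFst h p‖ ^ 2 + ‖sphereSnd h p‖ ^ 2 = 1 := by
  have h1 := one_sub_norm_cayley_sq hh (boundaryFst_re_nonneg p)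
  have h2 : ‖sphereSnd h p‖ ^ 2 = 2 * (boundaryFst p).re * h / ‖boundaryFst p + h / 2‖ ^ 2 := by
    rw [boundaryFst_re, sphereSnd, norm_div, norm_mul, div_pow, mul_pow, Complex.norm_real,
      Real.norm_of_nonneg (Real.sqrt_nonneg h), Real.sq_sqrt hh.le]
    ring
  rw [h2, ← h1, sphereFst]
  ring

/-- One factor |w₁ + h/2|² of the denominator is bounded below by its real part and the other by its
imaginary part; this yields the product majorant (1 + |w|²)⁻²(1 + v²)⁻¹ up to a constant. -/
theorem integrable_sphereDensity {h : ℝ} (hh : 0 < h) : Integrable (sphereDensity h) := by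
  have I1 : Integrable (fun w : ℂ => ((1 : ℝ) + ‖w‖ ^ 2) ^ (-(4 : ℝ) / 2)) :=
    integrable_rpow_neg_one_add_norm_sq (by rw [Complex.finrank_real_complex]; norm_num)
  have I2 := I1.mul_prod integrable_inv_one_add_sq
  -- Small enough for both bounds: m ≤ h/2 and m ≤ 1/2 handle |w|²/2 + h/2, and m ≤ 1 handles v².
  set m : ℝ := min h 1 / 2 with hm
  have hm0 : 0 < m := by positivity
  have hm1 : m ≤ h / 2 := by
    have := min_le_left h 1
    linarith
  have hm2 : m ≤ 1 / 2 := by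
    have := min_le_right h 1
    linarith
  refine (I2.const_mul (h ^ 2 / (m ^ 2 * m ^ 2))).mono'
    (measurable_sphereDensity h).aestronglyMeasurable (Eventually.of_forall fun p => ?_)
  have hn : 0 ≤ sphereDensity h p := cayleyDensity_nonneg _ _
  rw [Real.norm_of_nonneg hn]
  have e1 : ‖boundaryFst p + h / 2‖ ^ 2 = (‖p.1‖ ^ 2 / 2 + h / 2) ^ 2 + p.2 ^ 2 := by
    rw [← Complex.normSq_eq_norm_sq, Complex.normSq_apply]
    have : ((h : ℂ) / 2) = ((h / 2 : ℝ) : ℂ) := by push_cast; rfl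
    rw [this, Complex.add_re, Complex.add_im, boundaryFst_re, boundaryFst_im, Complex.ofReal_re,
      Complex.ofReal_im]
    ring
  have hw := norm_nonneg p.1
  have b1 : m * (1 + ‖p.1‖ ^ 2) ≤ ‖p.1‖ ^ 2 / 2 + h / 2 := by nlinarith [sq_nonneg ‖p.1‖]
  have b2 : m ^ 2 * (1 + ‖p.1‖ ^ 2) ^ 2 ≤ ‖boundaryFst p + h / 2‖ ^ 2 := by
    rw [e1, ← mul_pow]
    have : (m * (1 + ‖p.1‖ ^ 2)) ^ 2 ≤ (‖p.1‖ ^ 2 / 2 + h / 2) ^ 2 := by gcongr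
    nlinarith [sq_nonneg p.2]
  have b3 : m ^ 2 * (1 + p.2 ^ 2) ≤ ‖boundaryFst p + h / 2‖ ^ 2 := by
    rw [e1]
    have : m ^ 2 ≤ (‖p.1‖ ^ 2 / 2 + h / 2) ^ 2 := by
      have : m ≤ ‖p.1‖ ^ 2 / 2 + h / 2 := by nlinarith [sq_nonneg ‖p.1‖]
      gcongr
    have : m ^ 2 ≤ 1 := by nlinarith
    nlinarith [sq_nonneg p.2]
  have b4 : (m ^ 2 * (1 + ‖p.1‖ ^ 2) ^ 2) * (m ^ 2 * (1 + p.2 ^ 2)) ≤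
      ‖boundaryFst p + h / 2‖ ^ 4 := by
    rw [show ‖boundaryFst p + h / 2‖ ^ 4 =
      ‖boundaryFst p + h / 2‖ ^ 2 * ‖boundaryFst p + h / 2‖ ^ 2 by ring]
    gcongr
  have e2 : ((1 : ℝ) + ‖p.1‖ ^ 2) ^ (-(4 : ℝ) / 2) = ((1 + ‖p.1‖ ^ 2) ^ 2)⁻¹ := by
    rw [show (-(4 : ℝ) / 2) = -((2 : ℕ) : ℝ) by norm_num, Real.rpow_neg (by positivity),
      Real.rpow_natCast]
  rw [e2, sphereDensity, cayleyDensity]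
  calc h ^ 2 / ‖boundaryFst p + h / 2‖ ^ 4
      ≤ h ^ 2 / ((m ^ 2 * (1 + ‖p.1‖ ^ 2) ^ 2) * (m ^ 2 * (1 + p.2 ^ 2))) := by gcongr
    _ = _ := by field_simp

theorem integrable_mul_sphereDensity {h : ℝ} (hh : 0 < h) {f : ℂ × ℝ → ℂ} (hf : Measurable f)
    {C : ℝ} (hC : ∀ p, ‖f p‖ ≤ C) : Integrable fun p => f p * sphereDensity h p :=
  (integrable_sphereDensity hh).ofReal.bdd_mul hf.aestronglyMeasurable (Eventually.of_forall hC)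

theorem norm_sphereFst_le_one {h : ℝ} (hh : 0 < h) (p : ℂ × ℝ) : ‖sphereFst h p‖ ≤ 1 := by
  have := norm_sphereFst_sq_add hh p
  nlinarith [norm_nonneg (sphereFst h p), sq_nonneg ‖sphereSnd h p‖]

theorem norm_sphereSnd_le_one {h : ℝ} (hh : 0 < h) (p : ℂ × ℝ) : ‖sphereSnd h p‖ ≤ 1 := by
  have := norm_sphereFst_sq_add hh p
  nlinarith [norm_nonneg (sphereSnd h p), sq_nonneg ‖sphereFst h p‖]

/-- A monomial in the coordinates of the sphere and their conjugates. -/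
def sphereMonomial (h : ℝ) (a b c d : ℕ) (p : ℂ × ℝ) : ℂ :=
  sphereFst h p ^ a * sphereSnd h p ^ b * (conj (sphereFst h p) ^ c * conj (sphereSnd h p) ^ d)

theorem measurable_sphereMonomial (h : ℝ) (a b c d : ℕ) : Measurable (sphereMonomial h a b c d) := by
  have h1 := measurable_sphereFst h
  have h2 := measurable_sphereSnd h
  have h3 : Measurable fun p => conj (sphereFst h p) := Complex.continuous_conj.measurable.comp h1
  have h4 : Measurable fun p => conj (sphereSnd h p) := Complex.continuous_conj.measurable.comp h2
  unfold sphereMonomial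
  fun_prop

theorem norm_sphereMonomial_le_one {h : ℝ} (hh : 0 < h) (a b c d : ℕ) (p : ℂ × ℝ) :
    ‖sphereMonomial h a b c d p‖ ≤ 1 := by
  have h1 := norm_sphereFst_le_one hh p
  have h2 := norm_sphereSnd_le_one hh p
  simp only [sphereMonomial, norm_mul, norm_pow, RCLike.norm_conj]
  have := norm_nonneg (sphereFst h p)
  have := norm_nonneg (sphereSnd h p)
  have p1 := pow_le_one₀ (n := a) (norm_nonneg _) h1
  have p2 := pow_le_one₀ (n := b) (norm_nonneg _) h2
  have p3 := pow_le_one₀ (n := c) (norm_nonneg _) h1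
  have p4 := pow_le_one₀ (n := d) (norm_nonneg _) h2
  exact mul_le_one₀ (mul_le_one₀ p1 (by positivity) p2) (by positivity)
    (mul_le_one₀ p3 (by positivity) p4)

theorem integrable_sphereMonomial {h : ℝ} (hh : 0 < h) (a b c d : ℕ) :
    Integrable fun p => sphereMonomial h a b c d p * sphereDensity h p :=
  integrable_mul_sphereDensity hh (measurable_sphereMonomial h a b c d)
    (norm_sphereMonomial_le_one hh a b c d)

/-- Integration over the half plane in Cartesian coordinates. -/
theorem integral_integral_Ioi_eq_setIntegral_re_pos {f : ℂ → ℂ}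
    (hf : IntegrableOn f {z : ℂ | 0 < z.re}) :
    ∫ v : ℝ, ∫ x in Set.Ioi (0 : ℝ), f (x + Complex.I * v) = ∫ z in {z : ℂ | 0 < z.re}, f z := by
  have hmp := Complex.volume_preserving_equiv_real_prod.symm
  have hpre : Complex.measurableEquivRealProd.symm ⁻¹' {z : ℂ | 0 < z.re} =
      Set.Ioi (0 : ℝ) ×ˢ Set.univ := by
    ext ⟨x, y⟩
    simp [Complex.measurableEquivRealProd]
  have happ : ∀ q : ℝ × ℝ, Complex.measurableEquivRealProd.symm q = q.1 + Complex.I * q.2 := by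
    intro q
    apply Complex.ext <;> simp [Complex.measurableEquivRealProd]
  have e := hmp.setIntegral_preimage_emb Complex.measurableEquivRealProd.symm.measurableEmbedding f
    {z : ℂ | 0 < z.re}
  have hi := (hmp.integrableOn_comp_preimage
    Complex.measurableEquivRealProd.symm.measurableEmbedding).2 hf
  rw [← e, hpre]
  rw [hpre, IntegrableOn, Measure.volume_eq_prod, ← Measure.prod_restrict] at hi
  rw [Measure.volume_eq_prod, ← Measure.prod_restrict, integral_prod_symm (fun q => f (Complex.measurableEquivRealProd.symm q)) hi,
    Measure.restrict_univ]
  simp only [happ]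

/-- For fixed v the angle of w forces b = d. The remaining variables x = |w|²/2 and v fill the right
half plane, where |ζ₂|² = 1 - |ζ₁|², and the Cayley transform turns the integral into a Beta
integral over the disc. -/
theorem integral_sphereMonomial {h : ℝ} (hh : 0 < h) (a b c d : ℕ) :
    ∫ p, sphereMonomial h a b c d p * sphereDensity h p =
      if a = c ∧ b = d then 2 * (Real.pi : ℂ) ^ 2 * (a ! * b ! / (a + b + 1)!) else 0 := by
  have hint := integrable_sphereMonomial hh a b c d
  rw [Measure.volume_eq_prod] at hint ⊢
  rw [integral_prod_symm _ hint]
  have inner : ∀ v : ℝ, ∫ w : ℂ, sphereMonomial h a b c d (w, v) * sphereDensity h (w, v) =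
      if b = d then 2 * (Real.pi : ℂ) * ∫ x in Set.Ioi (0 : ℝ), (fun z : ℂ =>
        cayley h z ^ a * conj (cayley h z) ^ c * (1 - (‖cayley h z‖ : ℂ) ^ 2) ^ b *
          cayleyDensity h z) (x + Complex.I * v) else 0 := by
    intro v
    set B : ℝ → ℂ := fun y => ((y / 2 : ℝ) : ℂ) + Complex.I * v with hB
    -- For fixed v the integrand depends on w through |w|² only, apart from the factor w^b times
    -- conj w^d coming from ζ₂.
    set G : ℝ → ℂ := fun y => cayley h (B y) ^ a * conj (cayley h (B y)) ^ c *
      ((√h / (B y + h / 2)) ^ b * conj (√h / (B y + h / 2)) ^ d) * cayleyDensity h (B y) with hG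
    have e1 : ∀ w : ℂ, sphereMonomial h a b c d (w, v) * sphereDensity h (w, v) =
        w ^ b * conj w ^ d * G (‖w‖ ^ 2) := by
      intro w
      have e2 : boundaryFst (w, v) = B (‖w‖ ^ 2) := rfl
      have e3 : sphereSnd h (w, v) = w * (√h / (B (‖w‖ ^ 2) + h / 2)) := by
        rw [sphereSnd, e2]
        ring
      rw [sphereMonomial, e3, sphereDensity, sphereFst, e2, map_mul, mul_pow, mul_pow, hG]
      ring
    simp_rw [e1, integral_pow_mul_conj_pow_mul_radial]
    split_ifs with hbd
    · subst hbd
      -- The substitution y = 2x makes x the real part of the boundary coordinate; its factor 2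
      -- turns π into 2π.
      have e4 := integral_comp_mul_left_Ioi (fun y : ℝ => (y : ℂ) ^ b * G y) 0
        (b := 2) two_pos
      rw [mul_zero] at e4
      have e5 : ∫ y in Set.Ioi (0 : ℝ), (y : ℂ) ^ b * G y =
          2 * ∫ x in Set.Ioi (0 : ℝ), ((2 * x : ℝ) : ℂ) ^ b * G (2 * x) := by
        rw [e4, Complex.real_smul]
        push_cast
        rw [mul_inv_cancel_left₀ two_ne_zero]
      rw [e5, ← mul_assoc, mul_comm (Real.pi : ℂ) 2]
      congr 1
      refine setIntegral_congr_fun measurableSet_Ioi fun x hx => ?_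
      have hx' : (0 : ℝ) < x := hx
      have e6 : B (2 * x) = x + Complex.I * v := by
        simp only [hB]
        congr 2
        ring
      have hre : ((x : ℂ) + Complex.I * v).re = x := by simp
      have e7 := one_sub_norm_cayley_sq hh (z := x + Complex.I * v) (by rw [hre]; exact hx'.le)
      rw [hre] at e7
      have e8 : (1 - (‖cayley h (x + Complex.I * v)‖ : ℂ) ^ 2) =
          ((2 * x * h / ‖(x : ℂ) + Complex.I * v + h / 2‖ ^ 2 : ℝ) : ℂ) := by
        rw [← e7]
        push_cast
        rfl
      have e9 : (√h : ℂ) / ((x : ℂ) + Complex.I * v + h / 2) *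
          conj ((√h : ℂ) / ((x : ℂ) + Complex.I * v + h / 2)) =
          ((h / ‖(x : ℂ) + Complex.I * v + h / 2‖ ^ 2 : ℝ) : ℂ) := by
        rw [Complex.mul_conj, Complex.normSq_eq_norm_sq, norm_div, div_pow, Complex.norm_real,
          Real.norm_of_nonneg (Real.sqrt_nonneg h), Real.sq_sqrt hh.le]
      simp only [hG]
      rw [e6, ← mul_pow, e9, e8, show 2 * x * h / ‖(x : ℂ) + Complex.I * v + h / 2‖ ^ 2 =
        2 * x * (h / ‖(x : ℂ) + Complex.I * v + h / 2‖ ^ 2) by ring,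
        Complex.ofReal_mul (2 * x), mul_pow]
      ring
    · rfl
  simp_rw [inner]
  by_cases hbd : b = d
  · simp only [hbd, if_true, and_true]
    have hI : IntegrableOn (fun z => cayley h z ^ a * conj (cayley h z) ^ c *
        (1 - (‖cayley h z‖ : ℂ) ^ 2) ^ d * cayleyDensity h z) {z : ℂ | 0 < z.re} := by
      refine integrableOn_comp_cayley hh
        (g := fun u => u ^ a * conj u ^ c * (1 - (‖u‖ : ℂ) ^ 2) ^ d) ?_
      have hcont : Continuous fun u : ℂ => u ^ a * conj u ^ c * (1 - (‖u‖ : ℂ) ^ 2) ^ d := by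
        have := Complex.continuous_conj
        fun_prop
      exact (hcont.continuousOn.integrableOn_compact (isCompact_closedBall 0 1)).mono_set
        Metric.ball_subset_closedBall
    rw [integral_const_mul, integral_integral_Ioi_eq_setIntegral_re_pos hI,
      setIntegral_comp_cayley hh (fun u => u ^ a * conj u ^ c * (1 - (‖u‖ : ℂ) ^ 2) ^ d),
      integral_ball_pow_mul_conj_pow]
    split_ifs
    · ring
    · ring
  · simp [hbd]

/-- The linear form with coefficients `e₁`, `e₂` in the coordinates of the sphere. -/
def sphereForm (h : ℝ) (e₁ e₂ : ℂ) (p : ℂ × ℝ) : ℂ := e₁ * sphereFst h p + e₂ * sphereSnd h p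

theorem measurable_sphereForm (h : ℝ) (e₁ e₂ : ℂ) : Measurable (sphereForm h e₁ e₂) :=
  ((measurable_sphereFst h).const_mul e₁).add ((measurable_sphereSnd h).const_mul e₂)

theorem norm_sphereForm_sq_le {h : ℝ} (hh : 0 < h) (e₁ e₂ : ℂ) (p : ℂ × ℝ) :
    ‖sphereForm h e₁ e₂ p‖ ^ 2 ≤ ‖e₁‖ ^ 2 + ‖e₂‖ ^ 2 := by
  have h1 := norm_sphereFst_sq_add hh p
  have h2 : ‖sphereForm h e₁ e₂ p‖ ≤ ‖e₁‖ * ‖sphereFst h p‖ + ‖e₂‖ * ‖sphereSnd h p‖ := by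
    rw [← norm_mul, ← norm_mul]
    exact norm_add_le _ _
  calc ‖sphereForm h e₁ e₂ p‖ ^ 2
      ≤ (‖e₁‖ * ‖sphereFst h p‖ + ‖e₂‖ * ‖sphereSnd h p‖) ^ 2 := by gcongr
    _ ≤ (‖e₁‖ ^ 2 + ‖e₂‖ ^ 2) * (‖sphereFst h p‖ ^ 2 + ‖sphereSnd h p‖ ^ 2) := by
        nlinarith [sq_nonneg (‖e₁‖ * ‖sphereSnd h p‖ - ‖e₂‖ * ‖sphereFst h p‖)]
    _ = _ := by rw [h1, mul_one]

theorem norm_sphereForm_le {h : ℝ} (hh : 0 < h) (e₁ e₂ : ℂ) (p : ℂ × ℝ) :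
    ‖sphereForm h e₁ e₂ p‖ ≤ √(‖e₁‖ ^ 2 + ‖e₂‖ ^ 2) :=
  Real.le_sqrt_of_sq_le (norm_sphereForm_sq_le hh e₁ e₂ p)

/-- After binomial expansion only equal monomials pair to a nonzero value. Since C(m, j) j! (m - j)!
= m!, the diagonal terms recombine to (|e₁|² + |e₂|²)^m/(m + 1). -/
theorem integral_sphereForm_pow {h : ℝ} (hh : 0 < h) (e₁ e₂ : ℂ) (m n : ℕ) :
    ∫ p, sphereForm h e₁ e₂ p ^ m * conj (sphereForm h e₁ e₂ p) ^ n * sphereDensity h p =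
      if m = n then 2 * (Real.pi : ℂ) ^ 2 * ((‖e₁‖ ^ 2 + ‖e₂‖ ^ 2 : ℝ) : ℂ) ^ n / (n + 1) else 0 := by
  have e : ∀ p, sphereForm h e₁ e₂ p ^ m * conj (sphereForm h e₁ e₂ p) ^ n * sphereDensity h p =
      ∑ j ∈ Finset.range (m + 1), ∑ l ∈ Finset.range (n + 1),
        (e₁ ^ j * e₂ ^ (m - j) * m.choose j * (conj e₁ ^ l * conj e₂ ^ (n - l) * n.choose l)) *
          (sphereMonomial h j (m - j) l (n - l) p * sphereDensity h p) := by
    intro p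
    rw [sphereForm, map_add, map_mul, map_mul, add_pow, add_pow, Finset.sum_mul_sum, Finset.sum_mul]
    refine Finset.sum_congr rfl fun j _ => ?_
    rw [Finset.sum_mul]
    refine Finset.sum_congr rfl fun l _ => ?_
    rw [sphereMonomial]
    simp only [mul_pow]
    ring
  simp_rw [e]
  rw [integral_finsetSum _ fun j _ => integrable_finsetSum _ fun l _ =>
    (integrable_sphereMonomial hh j (m - j) l (n - l)).const_mul _]
  simp_rw [integral_finsetSum _ fun l _ =>
    (integrable_sphereMonomial hh _ (m - _) l (n - l)).const_mul _]
  simp_rw [integral_const_mul, integral_sphereMonomial hh]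
  split_ifs with hmn
  · subst hmn
    have hinner : ∀ j ∈ Finset.range (m + 1), ∑ l ∈ Finset.range (m + 1),
        (e₁ ^ j * e₂ ^ (m - j) * m.choose j * (conj e₁ ^ l * conj e₂ ^ (m - l) * m.choose l)) *
          (if j = l ∧ m - j = m - l then
            2 * (Real.pi : ℂ) ^ 2 * (j ! * (m - j)! / (j + (m - j) + 1)!) else 0) =
        2 * (Real.pi : ℂ) ^ 2 / (m + 1) * (((‖e₁‖ ^ 2 : ℝ) : ℂ) ^ j *
          ((‖e₂‖ ^ 2 : ℝ) : ℂ) ^ (m - j) * m.choose j) := by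
      intro j hj
      have hjm : j ≤ m := Nat.lt_succ_iff.1 (Finset.mem_range.1 hj)
      rw [Finset.sum_eq_single_of_mem j hj fun l _ hl => by
        rw [if_neg fun h => hl h.1.symm, mul_zero], if_pos ⟨rfl, rfl⟩,
        Nat.add_sub_cancel' hjm, ← Complex.normSq_eq_norm_sq, ← Complex.normSq_eq_norm_sq,
        ← Complex.mul_conj, ← Complex.mul_conj, mul_pow, mul_pow, Nat.factorial_succ]
      have hc : (m.choose j : ℂ) * j ! * (m - j)! = m ! := by
        exact_mod_cast Nat.choose_mul_factorial_mul_factorial hjm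
      have hm : (m ! : ℂ) ≠ 0 := by exact_mod_cast m.factorial_ne_zero
      have hm1 : (m : ℂ) + 1 ≠ 0 := by exact_mod_cast m.succ_ne_zero
      push_cast
      have hj0 : (j ! : ℂ) ≠ 0 := by exact_mod_cast j.factorial_ne_zero
      have hmj : ((m - j)! : ℂ) ≠ 0 := by exact_mod_cast (m - j).factorial_ne_zero
      rw [← hc] at hm ⊢
      field_simp
    rw [Finset.sum_congr rfl hinner, ← Finset.mul_sum, ← add_pow]
    push_cast
    ring
  · refine Finset.sum_eq_zero fun j hj => Finset.sum_eq_zero fun l hl => ?_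
    rw [if_neg, mul_zero]
    rw [Finset.mem_range] at hj hl
    omega

/-! ### The sphere integral as a Gauss series. -/

theorem ascPochhammer_eval_two (n : ℕ) : (ascPochhammer ℂ n).eval 2 = (n + 1)! := by
  induction n with
  | zero => simp
  | succ n ih =>
    rw [ascPochhammer_succ_eval, ih, Nat.factorial_succ (n + 1)]
    push_cast
    ring

theorem ne_neg_natCast_of_pos {x : ℝ} (hx : 0 < x) (n : ℕ) : (x : ℂ) ≠ -n := by
  intro h
  have := congrArg Complex.re h
  simp at this
  linarith [(Nat.cast_nonneg n : (0 : ℝ) ≤ n)]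

/-- The binomial series. -/
theorem hasSum_one_sub_cpow (α : ℂ) {u : ℂ} (hu : ‖u‖ < 1) :
    HasSum (fun n => ordinaryHypergeometricCoefficient α 1 1 n * u ^ n) ((1 - u) ^ (-α)) := by
  have h := (Complex.one_add_cpow_hasFPowerSeriesOnBall_zero (a := -α)).hasSum (y := -u)
    (by simpa [Metric.mem_eball, edist_zero_right, ← ofReal_norm] using hu)
  rw [binomialSeries_eq_ordinaryHypergeometricSeries (b := (1 : ℂ)) (by
    intro k hk
    have := ne_neg_natCast_of_pos one_pos k
    exact this (by push_cast; rw [hk, neg_neg])), neg_neg, zero_add] at h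
  have e : (fun n => ordinaryHypergeometricCoefficient α 1 1 n * u ^ n) = fun n =>
      (ordinaryHypergeometricSeries ℂ α 1 1).compContinuousLinearMap
        (-ContinuousLinearMap.id ℂ ℂ) n fun _ => -u := by
    ext n
    rw [FormalMultilinearSeries.compContinuousLinearMap_apply]
    have : (⇑(-(ContinuousLinearMap.id ℂ ℂ)) ∘ fun _ : Fin n => -u) = fun _ => u := by
      ext
      simp
    rw [this, ordinaryHypergeometricSeries_apply_eq, smul_eq_mul]
  rw [e, sub_eq_add_neg]
  exact h

/-- The n-th diagonal term is (α)ₙ(β)ₙ/(n!)² times 2π² Eⁿ/(n + 1), with E = |e₁|² + |e₂|²; since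
(2)ₙ = (n + 1)!, the third parameter is 2. -/
theorem integral_one_sub_sphereForm_cpow {h : ℝ} (hh : 0 < h) {e₁ e₂ : ℂ}
    (he : ‖e₁‖ ^ 2 + ‖e₂‖ ^ 2 < 1) (α β : ℂ) :
    ∫ p, (1 - sphereForm h e₁ e₂ p) ^ (-α) * (1 - conj (sphereForm h e₁ e₂ p)) ^ (-β) *
      sphereDensity h p = 2 * (Real.pi : ℂ) ^ 2 *
        ordinaryHypergeometric α β 2 ((‖e₁‖ ^ 2 + ‖e₂‖ ^ 2 : ℝ) : ℂ) := by
  set E : ℝ := ‖e₁‖ ^ 2 + ‖e₂‖ ^ 2 with hE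
  have hE0 : 0 ≤ E := by positivity
  have hr1 : √E < 1 := by rwa [Real.sqrt_lt' one_pos, one_pow]
  have hr0 := Real.sqrt_nonneg E
  have h1 : ∀ n : ℕ, (1 : ℂ) ≠ -n := fun n => by simpa using ne_neg_natCast_of_pos one_pos n
  have hA := unitDiscSummable_ordinaryHypergeometricCoefficient α 1 h1
  have hB := unitDiscSummable_ordinaryHypergeometricCoefficient β 1 h1
  set A := ordinaryHypergeometricCoefficient α 1 1 with hAdef
  set B := ordinaryHypergeometricCoefficient β 1 1 with hBdef
  set u := sphereForm h e₁ e₂ with hu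
  have hule : ∀ p, ‖u p‖ ≤ √E := norm_sphereForm_le hh e₁ e₂
  have hum : Measurable u := measurable_sphereForm h e₁ e₂
  have hucm : Measurable fun p => conj (u p) := Complex.continuous_conj.measurable.comp hum
  set F : ℕ × ℕ → ℂ × ℝ → ℂ := fun q p =>
    A q.1 * B q.2 * (u p ^ q.1 * conj (u p) ^ q.2 * sphereDensity h p) with hF
  have hbd : ∀ (q : ℕ × ℕ) p, ‖u p ^ q.1 * conj (u p) ^ q.2‖ ≤ √E ^ q.1 * √E ^ q.2 := by
    intro q p
    rw [norm_mul, norm_pow, norm_pow, RCLike.norm_conj]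
    have := hule p
    gcongr
  have hint0 : ∀ q : ℕ × ℕ, Integrable fun p =>
      u p ^ q.1 * conj (u p) ^ q.2 * (sphereDensity h p : ℂ) := fun q =>
    integrable_mul_sphereDensity hh ((hum.pow_const _).mul (hucm.pow_const _)) (hbd q)
  have hFint : ∀ q, Integrable (F q) := fun q => (hint0 q).const_mul _
  have hsum : Summable fun q => ∫ p, ‖F q p‖ := by
    -- Termwise integration: |u| ≤ √E < 1 uniformly, so the double series is dominated by a product
    -- of two convergent series times the total mass.
    have hs := ((hA _ hr0 hr1).mul_of_nonneg (hB _ hr0 hr1) (fun n => by positivity)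
      (fun n => by positivity)).mul_right (∫ p, sphereDensity h p)
    refine hs.of_nonneg_of_le (fun q => by positivity) fun q => ?_
    rw [← integral_const_mul]
    refine integral_mono (hFint q).norm ((integrable_sphereDensity hh).const_mul _) fun p => ?_
    have hd : 0 ≤ sphereDensity h p := cayleyDensity_nonneg _ _
    simp only [hF]
    rw [norm_mul, norm_mul (u p ^ q.1 * conj (u p) ^ q.2), norm_mul, Complex.norm_real,
      Real.norm_of_nonneg hd]
    calc ‖A q.1‖ * ‖B q.2‖ * (‖u p ^ q.1 * conj (u p) ^ q.2‖ * sphereDensity h p)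
        ≤ ‖A q.1‖ * ‖B q.2‖ * ((√E ^ q.1 * √E ^ q.2) * sphereDensity h p) := by
          gcongr
          exact hbd q p
      _ = _ := by ring
  have key := hasSum_integral_of_summable_integral_norm hFint hsum
  have hpt : ∀ p, ∑' q, F q p =
      (1 - u p) ^ (-α) * (1 - conj (u p)) ^ (-β) * sphereDensity h p := by
    intro p
    have hup : ‖u p‖ < 1 := (hule p).trans_lt hr1
    have hup' : ‖conj (u p)‖ < 1 := by rwa [RCLike.norm_conj]
    have s1 := hasSum_one_sub_cpow α hup
    have s2 := hasSum_one_sub_cpow β hup'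
    have n1 : Summable fun n => ‖A n * u p ^ n‖ := by
      simpa [norm_mul, norm_pow] using hA _ (norm_nonneg _) hup
    have n2 : Summable fun n => ‖B n * conj (u p) ^ n‖ := by
      simpa [norm_mul, norm_pow] using hB _ (norm_nonneg _) hup
    have := tsum_mul_tsum_of_summable_norm n1 n2
    rw [s1.tsum_eq, s2.tsum_eq] at this
    rw [this, ← tsum_mul_right]
    refine tsum_congr fun q => ?_
    simp only [hF]
    ring
  simp_rw [hpt] at key
  have hval : ∀ q : ℕ × ℕ, ∫ p, F q p = A q.1 * B q.2 *
      (if q.1 = q.2 then 2 * (Real.pi : ℂ) ^ 2 * (E : ℂ) ^ q.2 / (q.2 + 1) else 0) := by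
    intro q
    simp only [hF]
    rw [integral_const_mul, integral_sphereForm_pow hh]
  simp_rw [hval] at key
  -- Only the diagonal of ℕ × ℕ contributes, so the double sum reduces to a single one.
  have hinj : Function.Injective fun n : ℕ => (n, n) := fun a b hab => (Prod.ext_iff.1 hab).1
  rw [← hinj.hasSum_iff (by
    rintro ⟨m, n⟩ hmn
    rw [if_neg, mul_zero]
    exact fun e => hmn ⟨m, Prod.ext rfl e⟩)] at key
  rw [← key.tsum_eq, ordinaryHypergeometric_apply, ← tsum_mul_left]
  refine tsum_congr fun n => ?_
  have hn1 : (n : ℂ) + 1 ≠ 0 := by exact_mod_cast n.succ_ne_zero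
  have hn : (n ! : ℂ) ≠ 0 := by exact_mod_cast n.factorial_ne_zero
  simp only [Function.comp, if_true, hAdef, hBdef, ordinaryHypergeometricCoefficient,
    ascPochhammer_eval_two, ascPochhammer_eval_one, Nat.factorial_succ]
  push_cast
  field_simp

/-! ### Symmetries of ρ, Heisenberg translations and the integrand on the sphere. -/

theorem rho_star_star (Z W : ℂ × ℂ) : rho (star Z) (star W) = conj (rho Z W) := by
  simp [rho]

theorem rho_swap (Z W : ℂ × ℂ) : rho W Z = conj (rho Z W) := by
  simp [rho]
  ring

theorem sigma_comm (Z Z' : ℂ × ℂ) : sigma Z' Z = sigma Z Z' := by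
  rw [sigma, sigma, rho_swap, RCLike.norm_conj, mul_comm]

/-- Exchanging the points conjugates ρ(Z, Z'), so with k negated the two integer powers trade
places; σ and |k| do not change. -/
theorem pairKernel_swap (Z Z' : ℂ × ℂ) (k : ℤ) (s : ℂ) :
    pairKernel Z' Z (-k) s = pairKernel Z Z' k s := by
  simp only [pairKernel, abs_neg, sigma_comm, neg_neg, rho_star_star, rho_swap Z Z',
    Complex.conj_conj]
  ring

theorem phi_swap (Z Z' : ℂ × ℂ) (k : ℤ) (s : ℂ) : phi Z Z' k s = phi Z' Z (-k) (2 - s) := by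
  unfold phi
  congr 1
  ext W
  rw [kernelProduct, kernelProduct, neg_neg, sub_sub_cancel, mul_comm]

/-- The Heisenberg translation of the boundary by `(c, y)`. -/
def heisenbergShift (c : ℂ) (y : ℝ) (p : ℂ × ℝ) : ℂ × ℝ :=
  (p.1 + c, p.2 + (y + (conj c * p.1).im))

/-- A translation in w followed, for each w, by a translation in v. -/
theorem measurePreserving_heisenbergShift (c : ℂ) (y : ℝ) :
    MeasurePreserving (heisenbergShift c y) := by
  refine MeasurePreserving.skew_product (measurePreserving_add_right volume c)
    (g := fun w v => v + (y + (conj c * w).im)) ?_ (Eventually.of_forall fun w =>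
      (measurePreserving_add_right volume (y + (conj c * w).im)).map_eq)
  have : Continuous (Function.uncurry fun (w : ℂ) (v : ℝ) => v + (y + (conj c * w).im)) := by
    unfold Function.uncurry
    exact continuous_snd.add (continuous_const.add
      (Complex.continuous_im.comp (continuous_const.mul continuous_fst)))
  exact this.measurable

theorem height_eq (Z : ℂ × ℂ) : height Z = 2 * Z.1.re - ‖Z.2‖ ^ 2 := by
  rw [height, rho, ← Complex.normSq_eq_norm_sq, Complex.normSq_apply]
  simp
  ring

theorem two_mul_rho_re (Z Z' : ℂ × ℂ) :
    2 * (rho Z Z').re = height Z + height Z' + ‖Z.2 - Z'.2‖ ^ 2 := by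
  rw [height_eq, height_eq, rho]
  simp only [← Complex.normSq_eq_norm_sq, Complex.normSq_apply]
  simp
  ring

theorem rho_boundaryPoint_heisenbergShift (Z' : ℂ × ℂ) (p : ℂ × ℝ) :
    rho Z' (boundaryPoint (heisenbergShift Z'.2 Z'.1.im p)) = boundaryFst p + height Z' / 2 := by
  have e : ∀ q : ℂ × ℝ, boundaryPoint q = (boundaryFst q, q.1) := fun _ => rfl
  have h2 : ((height Z' : ℂ) / 2) = ((height Z' / 2 : ℝ) : ℂ) := by push_cast; rfl
  rw [e, rho, h2]
  apply Complex.ext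
  · simp only [Complex.add_re, Complex.sub_re, boundaryFst_re, Complex.ofReal_re, height_eq]
    simp only [heisenbergShift, ← Complex.normSq_eq_norm_sq, Complex.normSq_apply]
    simp
    ring
  · simp only [Complex.add_im, Complex.sub_im, boundaryFst_im, Complex.ofReal_im]
    simp [heisenbergShift]
    ring

/-- The quotient of `ρ(Z, W)` by `ρ(Z', W)`, in terms of the point of the sphere given by `W`. -/
theorem rho_boundaryPoint_heisenbergShift_eq {Z Z' : ℂ × ℂ} (hZ' : 0 < height Z')
    (hR : rho Z Z' ≠ 0) (p : ℂ × ℝ) :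
    rho Z (boundaryPoint (heisenbergShift Z'.2 Z'.1.im p)) =
      (boundaryFst p + height Z' / 2) * (rho Z Z' * ((height Z')⁻¹ : ℝ)) *
        (1 - sphereForm (height Z') ((rho Z Z' - height Z') / rho Z Z')
          (√(height Z') * conj (Z.2 - Z'.2) / rho Z Z') p) := by
  have h0 : (height Z' : ℂ) ≠ 0 := by exact_mod_cast hZ'.ne'
  have ha := add_half_ne_zero hZ' (boundaryFst_re_nonneg p)
  have hsq : (√(height Z') : ℂ) * √(height Z') = height Z' := by
    exact_mod_cast Real.mul_self_sqrt hZ'.le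
  have e1 : rho Z (boundaryPoint (heisenbergShift Z'.2 Z'.1.im p)) =
      rho Z' (boundaryPoint (heisenbergShift Z'.2 Z'.1.im p)) + (rho Z Z' - rho Z' Z') -
        conj (Z.2 - Z'.2) * p.1 := by
    simp only [rho, boundaryPoint, heisenbergShift, map_sub, Complex.star_def]
    ring
  rw [e1, rho_boundaryPoint_heisenbergShift, ← coe_height, sphereForm, sphereFst, sphereSnd,
    cayley, Complex.ofReal_inv]
  generalize boundaryFst p + (height Z' : ℂ) / 2 = a at *
  generalize rho Z Z' = R at *
  generalize conj (Z.2 - Z'.2) = d at *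
  generalize (√(height Z') : ℂ) = r at *
  rw [← hsq] at h0 ⊢
  have hr : r ≠ 0 := fun h => h0 (by rw [h, zero_mul])
  field_simp
  ring

/-- The identity `|e|² = 1 - 1 / σ(Z, Z')`. -/
theorem norm_sq_add_norm_sq_eq {Z Z' : ℂ × ℂ} (hZ' : 0 < height Z') (hR : rho Z Z' ≠ 0) :
    ‖(rho Z Z' - height Z') / rho Z Z'‖ ^ 2 +
      ‖√(height Z') * conj (Z.2 - Z'.2) / rho Z Z'‖ ^ 2 = 1 - (sigma Z Z')⁻¹ := by
  have hn : ‖rho Z Z'‖ ≠ 0 := norm_ne_zero_iff.2 hR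
  have h2 := two_mul_rho_re Z Z'
  have e : ‖rho Z Z' - height Z'‖ ^ 2 = ‖rho Z Z'‖ ^ 2 - 2 * height Z' * (rho Z Z').re +
      height Z' ^ 2 := by
    simp only [← Complex.normSq_eq_norm_sq, Complex.normSq_apply]
    simp
    ring
  rw [sigma, inv_div, norm_div, norm_div, norm_mul, RCLike.norm_conj, Complex.norm_real,
    Real.norm_of_nonneg (Real.sqrt_nonneg _), div_pow, div_pow, mul_pow, Real.sq_sqrt hZ'.le, e]
  field_simp
  linear_combination -height Z' * h2

theorem rho_ne_zero {Z Z' : ℂ × ℂ} (hZ : 0 < height Z) (hZ' : 0 < height Z') : rho Z Z' ≠ 0 := by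
  intro h
  have := two_mul_rho_re Z Z'
  rw [h, Complex.zero_re] at this
  nlinarith [sq_nonneg ‖Z.2 - Z'.2‖]

/-- 1 - 1/σ is the squared length of (e₁, e₂); if it were not positive, both entries would vanish,
which forces Z = Z'. -/
theorem one_lt_sigma {Z Z' : ℂ × ℂ} (hZ : 0 < height Z) (hZ' : 0 < height Z') (hne : Z ≠ Z') :
    1 < sigma Z Z' := by
  have hR := rho_ne_zero hZ hZ'
  have h := norm_sq_add_norm_sq_eq hZ' hR
  have hn : 0 < ‖rho Z Z'‖ := norm_pos_iff.2 hR
  have hpos : 0 < sigma Z Z' := by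
    unfold sigma
    positivity
  by_contra! hle
  have h1 : 1 ≤ (sigma Z Z')⁻¹ := (one_le_inv₀ hpos).2 hle
  have a1 := sq_nonneg ‖(rho Z Z' - height Z') / rho Z Z'‖
  have a2 := sq_nonneg ‖√(height Z') * conj (Z.2 - Z'.2) / rho Z Z'‖
  have b1 : ‖(rho Z Z' - height Z') / rho Z Z'‖ ^ 2 = 0 := by linarith
  have b2 : ‖√(height Z') * conj (Z.2 - Z'.2) / rho Z Z'‖ ^ 2 = 0 := by linarith
  have hs : √(height Z') ≠ 0 := (Real.sqrt_pos.2 hZ').ne'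
  simp [hR, hs, sub_eq_zero] at b1 b2
  replace b2 : Z.2 = Z'.2 := by simpa using congrArg conj b2
  apply hne
  rw [coe_height] at b1
  simp only [rho, b2, Complex.star_def] at b1
  refine Prod.ext ?_ b2
  have := congrArg conj (show conj Z.1 = conj Z'.1 by linear_combination b1)
  simpa using this

/-- Splits a complex power into integer powers and a power of the positive number |A|. Both are
multiplicative in A, so products can afterwards be separated without regard to branches. -/
theorem cpow_mul_conj_cpow {A : ℂ} (hA : 0 < A.re) (k : ℤ) (s : ℂ) :
    A ^ ((k : ℂ) - s) * conj A ^ (-(k : ℂ) - s) =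
      A ^ k * conj A ^ (-k) * (‖A‖ : ℂ) ^ (-2 * s) := by
  have h0 : A ≠ 0 := by
    rintro rfl
    simp at hA
  have h0' : conj A ≠ 0 := by simpa using h0
  have hn : (‖A‖ : ℂ) ≠ 0 := by simpa using h0
  have harg : A.arg ≠ Real.pi := Complex.slitPlane_arg_ne_pi (Or.inl hA)
  have hlog : Complex.log A + Complex.log (conj A) = 2 * Complex.log ‖A‖ := by
    rw [Complex.log_conj _ harg, Complex.add_conj, Complex.log_re, ← Complex.ofReal_log (norm_nonneg _)]
    push_cast
    rfl
  have key : A ^ (-s) * conj A ^ (-s) = (‖A‖ : ℂ) ^ (-2 * s) := by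
    rw [Complex.cpow_def_of_ne_zero h0, Complex.cpow_def_of_ne_zero h0',
      Complex.cpow_def_of_ne_zero hn, ← Complex.exp_add]
    congr 1
    linear_combination (-s) * hlog
  rw [← key, sub_eq_add_neg, sub_eq_add_neg, Complex.cpow_add _ _ h0, Complex.cpow_add _ _ h0',
    Complex.cpow_intCast, show -(k : ℂ) = ((-k : ℤ) : ℂ) by push_cast; rfl, Complex.cpow_intCast]
  ring

theorem rho_re_pos {Z : ℂ × ℂ} (hZ : 0 < height Z) (p : ℂ × ℝ) :
    0 < (rho Z (boundaryPoint p)).re := by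
  have h0 : height (boundaryPoint p) = 0 := by
    have : boundaryPoint p ∈ siegelBoundary := range_boundaryPoint ▸ ⟨p, rfl⟩
    exact this
  have := two_mul_rho_re Z (boundaryPoint p)
  rw [h0] at this
  nlinarith [sq_nonneg ‖Z.2 - (boundaryPoint p).2‖]

/-- The integrand of `phi` in the coordinates of the unit sphere. -/
theorem kernelProduct_boundaryPoint_heisenbergShift {Z Z' : ℂ × ℂ} (hZ : 0 < height Z)
    (hZ' : 0 < height Z') (k : ℤ) (s : ℂ) (p : ℂ × ℝ) {u : ℂ}
    (hu : u = sphereForm (height Z') ((rho Z Z' - height Z') / rho Z Z')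
      (√(height Z') * conj (Z.2 - Z'.2) / rho Z Z') p) (hu1 : ‖u‖ < 1) :
    kernelProduct Z Z' k s (boundaryPoint (heisenbergShift Z'.2 Z'.1.im p)) =
      rho Z Z' ^ k * rho (star Z) (star Z') ^ (-k) * (((sigma Z Z')⁻¹ : ℝ) : ℂ) ^ s *
        ((1 - u) ^ (-(s - k)) * (1 - conj u) ^ (-(s + k)) * sphereDensity (height Z') p) := by
  have hR := rho_ne_zero hZ hZ'
  set W := boundaryPoint (heisenbergShift Z'.2 Z'.1.im p) with hW
  have hA : 0 < (rho Z W).re := rho_re_pos hZ _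
  have hA' : 0 < (rho Z' W).re := rho_re_pos hZ' _
  have hy : 0 < (1 - u).re := by
    have := (Complex.re_le_norm u).trans_lt hu1
    simpa using this
  have hAeq := rho_boundaryPoint_heisenbergShift_eq hZ' hR p
  rw [← hu, ← rho_boundaryPoint_heisenbergShift, ← hW] at hAeq
  have e1 := cpow_mul_conj_cpow hA k s
  have e2 := cpow_mul_conj_cpow hA' (-k) (2 - s)
  have e3 := cpow_mul_conj_cpow hy k s
  have hdens : (sphereDensity (height Z') p : ℂ) =
      (height Z' : ℂ) ^ 2 * (‖rho Z' W‖ : ℂ) ^ (-4 : ℂ) := by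
    rw [sphereDensity, cayleyDensity, ← rho_boundaryPoint_heisenbergShift, ← hW, Complex.cpow_neg,
      show (4 : ℂ) = ((4 : ℕ) : ℂ) by norm_num, Complex.cpow_natCast]
    push_cast
    rfl
  have hconj : conj (1 - u) = 1 - conj u := by simp
  rw [hconj] at e3
  rw [kernelProduct, poissonKernel, poissonKernel, rho_star_star, rho_star_star, rho_star_star,
    hdens, show -(s - (k : ℂ)) = k - s by ring, show -(s + (k : ℂ)) = -k - s by ring, e3,
    mul_assoc ((height Z : ℂ) ^ s), e1, mul_assoc ((height Z' : ℂ) ^ (2 - s)), e2, ← hconj]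
  have hA0 : rho Z' W ≠ 0 := by
    intro h
    rw [h] at hA'
    simp at hA'
  have hn' : 0 < ‖rho Z' W‖ := norm_pos_iff.2 hA0
  have hnR : 0 < ‖rho Z Z'‖ := norm_pos_iff.2 hR
  have hnA : (‖rho Z W‖ : ℂ) ^ (-2 * s) = (‖rho Z' W‖ : ℂ) ^ (-2 * s) *
      ((‖rho Z Z'‖ : ℂ) ^ (-2 * s) * (height Z' : ℂ) ^ (2 * s)) * (‖1 - u‖ : ℂ) ^ (-2 * s) := by
    have hinv : (((height Z')⁻¹ : ℝ) : ℂ) ^ (-2 * s) = (height Z' : ℂ) ^ (2 * s) := by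
      rw [Complex.ofReal_inv, Complex.inv_cpow_ofReal_nonneg hZ'.le, ← Complex.cpow_neg]
      congr 1
      ring
    rw [hAeq, norm_mul, norm_mul, norm_mul, Complex.norm_real,
      Real.norm_of_nonneg (inv_pos.2 hZ').le, ← hinv, Complex.ofReal_mul,
      Complex.mul_cpow_ofReal_nonneg (by positivity) (norm_nonneg _), Complex.ofReal_mul,
      Complex.mul_cpow_ofReal_nonneg (norm_nonneg _) (by positivity), Complex.ofReal_mul,
      Complex.mul_cpow_ofReal_nonneg (norm_nonneg _) (by positivity)]
  have hsig : (((sigma Z Z')⁻¹ : ℝ) : ℂ) ^ s = (height Z : ℂ) ^ s * (height Z' : ℂ) ^ s *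
      (‖rho Z Z'‖ : ℂ) ^ (-2 * s) := by
    have h1 : (((‖rho Z Z'‖ ^ 2)⁻¹ : ℝ) : ℂ) ^ s = (‖rho Z Z'‖ : ℂ) ^ (-2 * s) := by
      rw [Complex.ofReal_inv, Complex.inv_cpow_ofReal_nonneg (by positivity), sq,
        Complex.ofReal_mul, Complex.mul_cpow_ofReal_nonneg hnR.le hnR.le,
        ← Complex.cpow_add _ _ (by exact_mod_cast hnR.ne'), ← Complex.cpow_neg]
      congr 1
      ring
    rw [sigma, inv_div, div_eq_mul_inv, Complex.ofReal_mul,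
      Complex.mul_cpow_ofReal_nonneg (by positivity) (by positivity), h1, Complex.ofReal_mul,
      Complex.mul_cpow_ofReal_nonneg hZ.le hZ'.le]
  -- The exponents -2s, from ρ(Z, W), and -2(2 - s), from ρ(Z', W), add up to -4, the exponent of
  -- the sphere density.
  have hpow1 : (‖rho Z' W‖ : ℂ) ^ (-2 * s) * (‖rho Z' W‖ : ℂ) ^ (-2 * (2 - s)) =
      (‖rho Z' W‖ : ℂ) ^ (-4 : ℂ) := by
    rw [← Complex.cpow_add _ _ (by exact_mod_cast hn'.ne')]
    congr 1
    ring
  have hh0 : (height Z' : ℂ) ≠ 0 := by exact_mod_cast hZ'.ne'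
  have hpow2 : (height Z' : ℂ) ^ (2 - s) * (height Z' : ℂ) ^ (2 * s) =
      (height Z' : ℂ) ^ s * (height Z' : ℂ) ^ 2 := by
    rw [← Complex.cpow_natCast, ← Complex.cpow_add _ _ hh0, ← Complex.cpow_add _ _ hh0]
    congr 1
    push_cast
    ring
  -- The opposite weights k and -k cancel the phase of ρ(Z', W), and the real factor 1/h has none.
  have hz : rho Z W ^ k * conj (rho Z W) ^ (-k) * (rho Z' W ^ (-k) * conj (rho Z' W) ^ (- -k)) =
      rho Z Z' ^ k * conj (rho Z Z') ^ (-k) * ((1 - u) ^ k * conj (1 - u) ^ (-k)) := by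
    have hc0 : conj (rho Z' W) ≠ 0 := by simpa using hA0
    have hi0 : (((height Z')⁻¹ : ℝ) : ℂ) ≠ 0 := by exact_mod_cast (inv_pos.2 hZ').ne'
    have t1 : rho Z' W ^ k * rho Z' W ^ (-k) = 1 := by
      rw [← zpow_add₀ hA0, add_neg_cancel, zpow_zero]
    have t2 : conj (rho Z' W) ^ (-k) * conj (rho Z' W) ^ (- -k) = 1 := by
      rw [← zpow_add₀ hc0, add_neg_cancel, zpow_zero]
    have t3 : (((height Z')⁻¹ : ℝ) : ℂ) ^ k * (((height Z')⁻¹ : ℝ) : ℂ) ^ (-k) = 1 := by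
      rw [← zpow_add₀ hi0, add_neg_cancel, zpow_zero]
    rw [hAeq]
    simp only [map_mul, Complex.conj_ofReal, mul_zpow]
    linear_combination (rho Z Z' ^ k * conj (rho Z Z') ^ (-k) *
      ((1 - u) ^ k * conj (1 - u) ^ (-k))) * ((((height Z')⁻¹ : ℝ) : ℂ) ^ k *
      (((height Z')⁻¹ : ℝ) : ℂ) ^ (-k) * (conj (rho Z' W) ^ (-k) * conj (rho Z' W) ^ (- -k)) * t1 +
      (((height Z')⁻¹ : ℝ) : ℂ) ^ k * (((height Z')⁻¹ : ℝ) : ℂ) ^ (-k) * t2 + t3)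
  rw [hnA, hsig]
  generalize rho Z W ^ k * conj (rho Z W) ^ (-k) = x1 at *
  generalize rho Z' W ^ (-k) * conj (rho Z' W) ^ (- -k) = x2 at *
  generalize (1 - u) ^ k * conj (1 - u) ^ (-k) = x3 at *
  generalize rho Z Z' ^ k * conj (rho Z Z') ^ (-k) = x4 at *
  generalize (‖rho Z' W‖ : ℂ) ^ (-2 * s) = y1 at *
  generalize (‖rho Z' W‖ : ℂ) ^ (-2 * (2 - s)) = y2 at *
  generalize (‖rho Z Z'‖ : ℂ) ^ (-2 * s) = y3 at *
  generalize (‖1 - u‖ : ℂ) ^ (-2 * s) = y4 at *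
  generalize (height Z : ℂ) ^ s = g1 at *
  generalize (height Z' : ℂ) ^ s = g2 at *
  generalize (height Z' : ℂ) ^ (2 - s) = g3 at *
  generalize (height Z' : ℂ) ^ (2 * s) = g4 at *
  rw [← hpow1]
  linear_combination g1 * y1 * y2 * y3 * y4 * (g3 * g4 * hz + x4 * x3 * hpow2)

/-! ### Absolute convergence and the value of the integral. -/

theorem norm_one_sub_cpow_le (α : ℂ) {r : ℝ} (hr0 : 0 ≤ r) (hr1 : r < 1) {u : ℂ} (hu : ‖u‖ ≤ r) :
    ‖(1 - u) ^ (-α)‖ ≤ ∑' n, ‖ordinaryHypergeometricCoefficient α 1 1 n‖ * r ^ n := by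
  have hs := unitDiscSummable_ordinaryHypergeometricCoefficient α 1
    (fun n => by simpa using ne_neg_natCast_of_pos one_pos n) r hr0 hr1
  rw [← (hasSum_one_sub_cpow α (hu.trans_lt hr1)).tsum_eq]
  refine tsum_of_norm_bounded hs.hasSum fun n => ?_
  rw [norm_mul, norm_pow]
  gcongr

theorem integrable_one_sub_sphereForm_cpow {h : ℝ} (hh : 0 < h) {e₁ e₂ : ℂ}
    (he : ‖e₁‖ ^ 2 + ‖e₂‖ ^ 2 < 1) (α β : ℂ) :
    Integrable fun p => (1 - sphereForm h e₁ e₂ p) ^ (-α) *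
      (1 - conj (sphereForm h e₁ e₂ p)) ^ (-β) * sphereDensity h p := by
  have hr1 : √(‖e₁‖ ^ 2 + ‖e₂‖ ^ 2) < 1 := by rwa [Real.sqrt_lt' one_pos, one_pow]
  have hr0 := Real.sqrt_nonneg (‖e₁‖ ^ 2 + ‖e₂‖ ^ 2)
  have hm := measurable_sphereForm h e₁ e₂
  have hcm : Measurable fun p => conj (sphereForm h e₁ e₂ p) :=
    Complex.continuous_conj.measurable.comp hm
  refine integrable_mul_sphereDensity hh (((hm.const_sub 1).pow_const _).mul
    ((hcm.const_sub 1).pow_const _)) (C := (∑' n, ‖ordinaryHypergeometricCoefficient α 1 1 n‖ *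
      √(‖e₁‖ ^ 2 + ‖e₂‖ ^ 2) ^ n) * ∑' n, ‖ordinaryHypergeometricCoefficient β 1 1 n‖ *
      √(‖e₁‖ ^ 2 + ‖e₂‖ ^ 2) ^ n) fun p => ?_
  have hu := norm_sphereForm_le hh e₁ e₂ p
  rw [norm_mul]
  gcongr
  · exact norm_one_sub_cpow_le α hr0 hr1 hu
  · exact norm_one_sub_cpow_le β hr0 hr1 (by rwa [RCLike.norm_conj])

theorem measurable_kernelProduct (Z Z' : ℂ × ℂ) (k : ℤ) (s : ℂ) :
    Measurable (kernelProduct Z Z' k s) := by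
  have h1 : ∀ Z : ℂ × ℂ, Measurable fun W => rho Z W := fun Z => by
    unfold rho
    fun_prop
  have h2 : ∀ Z : ℂ × ℂ, Measurable fun W => rho (star Z) (star W) := fun Z => by
    simp only [rho_star_star]
    exact Complex.continuous_conj.measurable.comp (h1 Z)
  have h3 : ∀ (Z : ℂ × ℂ) (k : ℤ) (s : ℂ), Measurable fun W => poissonKernel k Z W s :=
    fun Z k s => (((h1 Z).pow_const _).const_mul _).mul ((h2 Z).pow_const _)
  exact (h3 Z k s).mul (h3 Z' (-k) (2 - s))

/-- The measure is an image under `boundaryPoint`, whose values all lie on the boundary. -/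
theorem boundaryMeasure_restrict : boundaryMeasure.restrict siegelBoundary = boundaryMeasure := by
  refine Measure.restrict_eq_self_of_ae_mem ?_
  have hs : MeasurableSet siegelBoundary := by
    have : Continuous height := by
      unfold height rho
      fun_prop
    exact this.measurable (measurableSet_singleton 0)
  refine (ae_map_iff (p := fun W => W ∈ siegelBoundary) continuous_boundaryPoint.aemeasurable
    hs).2 ?_
  exact Eventually.of_forall fun p => range_boundaryPoint ▸ ⟨p, rfl⟩

section

variable {Z Z' : ℂ × ℂ} (hZ : 0 < height Z) (hZ' : 0 < height Z') (hne : Z ≠ Z') (k : ℤ) (s : ℂ)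

include hZ hZ' hne

theorem norm_sq_add_norm_sq_lt_one : ‖(rho Z Z' - height Z') / rho Z Z'‖ ^ 2 +
    ‖√(height Z') * conj (Z.2 - Z'.2) / rho Z Z'‖ ^ 2 < 1 := by
  rw [norm_sq_add_norm_sq_eq hZ' (rho_ne_zero hZ hZ')]
  have := inv_pos.2 (one_pos.trans (one_lt_sigma hZ hZ' hne))
  linarith

theorem kernelProduct_comp_eq :
    (fun p => kernelProduct Z Z' k s (boundaryPoint (heisenbergShift Z'.2 Z'.1.im p))) = fun p =>
      rho Z Z' ^ k * rho (star Z) (star Z') ^ (-k) * (((sigma Z Z')⁻¹ : ℝ) : ℂ) ^ s *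
        ((1 - sphereForm (height Z') ((rho Z Z' - height Z') / rho Z Z')
          (√(height Z') * conj (Z.2 - Z'.2) / rho Z Z') p) ^ (-(s - k)) *
        (1 - conj (sphereForm (height Z') ((rho Z Z' - height Z') / rho Z Z')
          (√(height Z') * conj (Z.2 - Z'.2) / rho Z Z') p)) ^ (-(s + k)) *
          sphereDensity (height Z') p) := by
  have he := norm_sq_add_norm_sq_lt_one hZ hZ' hne
  funext p
  refine kernelProduct_boundaryPoint_heisenbergShift hZ hZ' k s p rfl ?_
  have := (norm_sphereForm_sq_le hZ' _ _ p).trans_lt he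
  exact (sq_lt_one_iff₀ (norm_nonneg _)).1 this

theorem integrable_kernelProduct : Integrable (kernelProduct Z Z' k s) boundaryMeasure := by
  have hm := measurable_kernelProduct Z Z' k s
  have hb := continuous_boundaryPoint.measurable
  rw [boundaryMeasure, integrable_map_measure hm.aestronglyMeasurable hb.aemeasurable,
    ← (measurePreserving_heisenbergShift Z'.2 Z'.1.im).integrable_comp
      (hm.comp hb).aestronglyMeasurable]
  have : (kernelProduct Z Z' k s ∘ boundaryPoint) ∘ heisenbergShift Z'.2 Z'.1.im =
    fun p => kernelProduct Z Z' k s (boundaryPoint (heisenbergShift Z'.2 Z'.1.im p)) := rfl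
  rw [this, kernelProduct_comp_eq hZ hZ' hne]
  exact (integrable_one_sub_sphereForm_cpow hZ'
    (norm_sq_add_norm_sq_lt_one hZ hZ' hne) _ _).const_mul _

theorem phi_eq : phi Z Z' k s =
    rho Z Z' ^ k * rho (star Z) (star Z') ^ (-k) * (2 * Real.pi ^ 2 *
      (((sigma Z Z')⁻¹ : ℝ) : ℂ) ^ s *
        ordinaryHypergeometric (s - k) (s + k) 2 (1 - ((sigma Z Z')⁻¹ : ℝ) : ℂ)) := by
  have hm := measurable_kernelProduct Z Z' k s
  have hb := continuous_boundaryPoint.measurable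
  have hT := measurePreserving_heisenbergShift Z'.2 Z'.1.im
  rw [phi, boundaryMeasure_restrict, boundaryMeasure,
    integral_map hb.aemeasurable hm.aestronglyMeasurable]
  rw [← hT.map_eq, integral_map (f := fun p => kernelProduct Z Z' k s (boundaryPoint p))
    hT.measurable.aemeasurable (hm.comp hb).aestronglyMeasurable, kernelProduct_comp_eq hZ hZ' hne, integral_const_mul,
    integral_one_sub_sphereForm_cpow hZ' (norm_sq_add_norm_sq_lt_one hZ hZ' hne),
    norm_sq_add_norm_sq_eq hZ' (rho_ne_zero hZ hZ')]
  push_cast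
  ring

end

theorem phi_eq_pairKernel_add_pairKernel {Z Z' : ℂ × ℂ} (hZ : 0 < height Z) (hZ' : 0 < height Z')
    (hne : Z ≠ Z') {k : ℤ} (hk : k = 0 ∨ k = 1) {s : ℂ} (hs₁ : ∀ n : ℕ, 2 * s - 1 ≠ -(n : ℂ))
    (hs₂ : ∀ n : ℕ, 2 * (2 - s) - 1 ≠ -(n : ℂ)) (hs₃ : k = 0 → s ≠ 1) :
    phi Z Z' k s = pairKernel Z Z' k s + pairKernel Z Z' k (2 - s) := by
  rw [phi_eq hZ hZ' hne, pairKernel_add_pairKernel (one_lt_sigma hZ hZ' hne) hk hs₁ hs₂ hs₃]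

end SiegelProduct

end

theorem theorem4p10 (Z Z' : ℂ × ℂ) (hZ : Z ∈ SiegelProduct.siegelDomain)
    (hZ' : Z' ∈ SiegelProduct.siegelDomain) (hne : Z ≠ Z')
    (k : ℤ) (hk : k = 0 ∨ k = 1 ∨ k = -1) (s : ℂ)
    (hs₁ : ∀ n : ℕ, 2 * s - 1 ≠ -(n : ℂ)) (hs₂ : ∀ n : ℕ, 2 * (2 - s) - 1 ≠ -(n : ℂ))
    (hs₃ : k = 0 → s ≠ 1) :
    IntegrableOn (SiegelProduct.kernelProduct Z Z' k s) SiegelProduct.siegelBoundary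
        SiegelProduct.boundaryMeasure ∧
      SiegelProduct.phi Z Z' k s =
        SiegelProduct.pairKernel Z Z' k s + SiegelProduct.pairKernel Z Z' k (2 - s) ∧
      SiegelProduct.phi Z Z' k s = SiegelProduct.phi Z' Z (-k) (2 - s) ∧
      SiegelProduct.phi Z Z' k s =
        SiegelProduct.pairKernel Z' Z (-k) s + SiegelProduct.pairKernel Z' Z (-k) (2 - s) := by
  have main : SiegelProduct.phi Z Z' k s =
      SiegelProduct.pairKernel Z Z' k s + SiegelProduct.pairKernel Z Z' k (2 - s) := by
    -- Weight -1 at (Z, Z', s) is weight 1 at (Z', Z, 2 - s); the two hypotheses on s then change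
    -- roles and the two kernels change order.
    by_cases h : k = -1
    · subst h
      rw [SiegelProduct.phi_swap, neg_neg,
        SiegelProduct.phi_eq_pairKernel_add_pairKernel hZ' hZ hne.symm (Or.inr rfl) hs₂
          (by rwa [sub_sub_cancel]) (by simp), sub_sub_cancel, add_comm,
        ← SiegelProduct.pairKernel_swap Z Z' (-1) s,
        ← SiegelProduct.pairKernel_swap Z Z' (-1) (2 - s), neg_neg]
    · have hk' : k = 0 ∨ k = 1 := by
        rcases hk with hk | hk | hk
        · exact Or.inl hk
        · exact Or.inr hk
        · exact absurd hk h
      exact SiegelProduct.phi_eq_pairKernel_add_pairKernel hZ hZ' hne hk' hs₁ hs₂ hs₃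
  refine ⟨(SiegelProduct.integrable_kernelProduct hZ hZ' hne k s).integrableOn, main,
    SiegelProduct.phi_swap Z Z' k s, ?_⟩
  rw [SiegelProduct.pairKernel_swap, SiegelProduct.pairKernel_swap, main]
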